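/- Let $N,d\ge 1$. Observe $\mathbf y_i=\mathbf f^i+\varepsilon_i$, $i=1,\dots,N$, where the $\mathbf f^i\in\mathbb R^d$ are nonrandom and $\varepsilon_1,\dots,\varepsilon_N$ are i.i.d. random vectors in $\mathbb R^d$ with $\mathbb E(\varepsilon_1)=0$ and covariance matrix $V(\varepsilon_1)=\Phi$. Write $\mathbf f,\mathbf y\in\mathbb R^{Nd}$ for the stacked vectors, and for $a=(a_1,\dots,a_N)$ with $a_i\in\mathbb R^d$ put $\|a\|_N^2=\frac1N\sum_{i=1}^N a_i^Ta_i$. Let $(\mathcal L_m)_{m\in\mathcal M}$ be a finite nonempty family of linear subspaces of $\mathbb R^{Nd}$ with dimensions $D_m\ge 1$, let $\mathbf P_m$ be the orthogonal projector onto $\mathcal L_m$, and let $\hat{\mathbf f}_m=\mathbf P_m\mathbf y$ be the least squares estimator of $\mathbf f$ over $\mathcal L_m$. Write $$\delta_m^2=\frac{\mathrm{Tr}(\mathbf P_m(\mathbf I_N\otimes\Phi))}{D_m},\qquad \delta_{\sup}^2=\max_{m\in\mathcal M}\delta_m^2,$$ and assume $\delta_m>0$ for all $m\in\mathcal M$.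 For $\theta>0$ let $\tilde{\mathbf f}=\hat{\mathbf f}_{\hat m}$, where $\hat m$ is any (measurable) minimizer over $m\in\mathcal M$ of $$\|\mathbf y-\hat{\mathbf f}_m\|_N^2+\mathrm{pen}(m),\qquad \mathrm{pen}(m)=(1+\theta)\frac{\delta_m^2D_m}{N}.$$ Let $q>0$ and suppose that $\mathbb E\|\varepsilon_1\|^p<\infty$ for some $p>2(1+q)$. Then, for some constants $K(\theta)>1$, depending only on $\theta$, and $C(\theta,p,q)>0$, depending only on $\theta,p,q$, $$\mathbb E\Big[\big(\|\mathbf f-\tilde{\mathbf f}\|_N^2-K(\theta)\,\mathcal M^*\big)_+^q\Big]\le\Delta_p^q\,\frac{\delta_{\sup}^{2q}}{N^q},$$ where $$\Delta_p^q=C(\theta,p,q)\,\mathbb E\|\varepsilon_1\|^p\sum_{m\in\mathcal M}\delta_m^{-p}D_m^{-(p/2-1-q)},\qquad \mathcal M^*=\inf_{m\in\mathcal M}\Big\{\|\mathbf f-\mathbf P_m\mathbf f\|_N^2+\frac{\delta_m^2D_m}{N}\Big\}.$$ -/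

import Mathlib

open MeasureTheory ProbabilityTheory
open scoped Kronecker

namespace MultiReg

/-- The space `ℝ^{Nd}`, whose coordinates are indexed by pairs (observation `i`, component `j`). -/
abbrev Obs (N d : ℕ) : Type := EuclideanSpace ℝ (Fin N × Fin d)

/-- Stacking `N` vectors of `ℝ^d` into one vector of `ℝ^{Nd}`. -/
def stack {N d : ℕ} (g : Fin N → EuclideanSpace ℝ (Fin d)) : Obs N d :=
  WithLp.toLp 2 fun ij => g ij.1 ij.2

/-- The empirical inner product `⟨a, b⟩_N = (1/N) ∑ᵢ aᵢᵀ bᵢ` on `ℝ^{Nd}`. -/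
noncomputable def innerN {N d : ℕ} (a b : Obs N d) : ℝ :=
  (1 / (N : ℝ)) * ∑ i : Fin N, ∑ j : Fin d, a (i, j) * b (i, j)

/-- The squared empirical norm `‖a‖_N² = ⟨a, a⟩_N`. -/
noncomputable def normSqN {N d : ℕ} (a : Obs N d) : ℝ := innerN a a

theorem normSqN_eq {N d : ℕ} (a : Obs N d) : normSqN a = ‖a‖ ^ 2 / N := by
  rw [normSqN, innerN, EuclideanSpace.norm_sq_eq, Fintype.sum_prod_type]
  simp only [Real.norm_eq_abs, sq_abs, ← sq]
  ring

/-- The orthogonal projector `P_L` of `ℝ^{Nd}` onto the linear subspace `L`. (The Euclidean and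
the empirical inner product are proportional, so they give the same projector.) -/
noncomputable def proj {N d : ℕ} (L : Submodule ℝ (Obs N d)) (v : Obs N d) : Obs N d :=
  L.starProjection v

/-- `proj L y` is the least squares estimator over `L`: it lies in `L`, minimizes
`v ↦ ‖y - v‖_N²` over `L`, and is the only minimizer. -/
theorem proj_leastSquares {N d : ℕ} [NeZero N] (L : Submodule ℝ (Obs N d)) (y : Obs N d) :
    proj L y ∈ L ∧ ∀ v ∈ L, normSqN (y - proj L y) ≤ normSqN (y - v) ∧
      (normSqN (y - v) ≤ normSqN (y - proj L y) → v = proj L y) := by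
  have hmem : proj L y ∈ L := Submodule.starProjection_apply_mem L y
  refine ⟨hmem, fun v hv => ?_⟩
  have hN : (0 : ℝ) < N := Nat.cast_pos.mpr (NeZero.pos N)
  have ho : inner ℝ (y - proj L y) (proj L y - v) = 0 :=
    Submodule.starProjection_inner_eq_zero y _ (L.sub_mem hmem hv)
  have hp : ‖y - v‖ ^ 2 = ‖y - proj L y‖ ^ 2 + ‖proj L y - v‖ ^ 2 := by
    have h := norm_add_sq_eq_norm_sq_add_norm_sq_of_inner_eq_zero _ _ ho
    rw [sub_add_sub_cancel] at h
    simpa only [sq] using h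
  rw [normSqN_eq, normSqN_eq, hp, div_le_div_iff_of_pos_right hN,
    div_le_div_iff_of_pos_right hN]
  refine ⟨by nlinarith [sq_nonneg ‖proj L y - v‖], fun h => ?_⟩
  have h0 : ‖proj L y - v‖ ^ 2 = 0 := le_antisymm (by linarith) (sq_nonneg _)
  exact (sub_eq_zero.mp (norm_eq_zero.mp (pow_eq_zero_iff two_ne_zero |>.mp h0))).symm

/-- The matrix of the orthogonal projector onto `L` in the standard basis of `ℝ^{Nd}`. -/
noncomputable def projMatrix {N d : ℕ} (L : Submodule ℝ (Obs N d)) :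
    Matrix (Fin N × Fin d) (Fin N × Fin d) ℝ :=
  Matrix.of fun a b => proj L (EuclideanSpace.single b 1) a

/-- The covariance matrix `V(z) = (cov(zⱼ, zₖ))` of a random vector `z` of `ℝ^d`. -/
noncomputable def covMatrix {d : ℕ} {Ω : Type*} [MeasurableSpace Ω]
    (z : Ω → EuclideanSpace ℝ (Fin d)) (μ : Measure Ω) : Matrix (Fin d) (Fin d) ℝ :=
  Matrix.of fun j k => covariance (fun ω => z ω j) (fun ω => z ω k) μ

/-- The dimension `D` of a model, as a real number. -/
noncomputable def dim {N d : ℕ} (L : Submodule ℝ (Obs N d)) : ℝ := (Module.finrank ℝ L : ℝ)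

/-- `δ² = Tr(P (I_N ⊗ Φ)) / D` for the model `L` and the noise covariance `Φ`. -/
noncomputable def deltaSq {N d : ℕ} (L : Submodule ℝ (Obs N d)) (Φ : Matrix (Fin d) (Fin d) ℝ) :
    ℝ :=
  (projMatrix L * ((1 : Matrix (Fin N) (Fin N) ℝ) ⊗ₖ Φ)).trace / dim L

/-- The penalty `(1 + θ) δ² D / N`. -/
noncomputable def pen {N d : ℕ} (θ : ℝ) (Φ : Matrix (Fin d) (Fin d) ℝ)
    (L : Submodule ℝ (Obs N d)) : ℝ :=
  (1 + θ) * (deltaSq L Φ * dim L / N)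

/-- The penalized least squares criterion `‖y - P_L y‖_N² + pen(L)`. -/
noncomputable def crit {N d : ℕ} (θ : ℝ) (Φ : Matrix (Fin d) (Fin d) ℝ) (y : Obs N d)
    (L : Submodule ℝ (Obs N d)) : ℝ :=
  normSqN (y - proj L y) + pen θ Φ L

/-- `M* = inf_m (‖f - P_m f‖_N² + δ_m² D_m / N)` for a family `L` of models. -/
noncomputable def oracle {N d : ℕ} {ι : Type*} (Φ : Matrix (Fin d) (Fin d) ℝ) (f : Obs N d)
    (L : ι → Submodule ℝ (Obs N d)) : ℝ :=
  ⨅ m, (normSqN (f - proj (L m) f) + deltaSq (L m) Φ * dim (L m) / N)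

/-- `δ_sup² = max_m δ_m²` for a (finite, nonempty) family `L` of models. -/
noncomputable def deltaSupSq {N d : ℕ} {ι : Type*} (Φ : Matrix (Fin d) (Fin d) ℝ)
    (L : ι → Submodule ℝ (Obs N d)) : ℝ :=
  ⨆ m, deltaSq (L m) Φ

end MultiReg

/-!
The heart of the matter is a deviation inequality for `‖P ε‖`, where `P` is the projector onto a
model and `ε` the stacked noise: with `A² = (1 + η) E‖P ε‖²`,
`E (‖P ε‖ - A)₊^p ≤ C(η, p) D E‖ε₁‖^p`. Write `P ε = S = ∑ X_i` with independent centred `X_i`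
coming from the individual observations, and let `l` bound the weak variance
`∑ E⟨u, X_i⟩²` over unit vectors `u`. The bound
`E (‖S‖ - A)₊^p ≤ C (∑ E‖X_i‖^p + l^{p/2})` (`exists_integral_excess_rpow_le`) is proved by testing
`S` against the field `v(x) = (‖x‖ - A)₊^{p-1} x / ‖x‖`. With `V = (‖S‖ - A)₊`,
`E V^p = ∑ E⟨X_i, v(S)⟩ - A E V^{p-1}`.
Since `X_i` is centred and independent of `S - X_i`, each `E⟨X_i, v(S)⟩` is the expectation of
`⟨X', v(x + X') - v(x)⟩` with `x = S - X_i` and `X'` an independent copy of `X_i`; to second order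
this is at most `V_x^{p-1} ‖X'‖² / A + (p - 1) V_x^{p-2} ⟨x / ‖x‖, X'⟩²`
(`exists_decoupled_increment_le`). The first terms add up to at most
`(E‖S‖² / A) E V^{p-1}`, up to a factor `1 + η`, and are cancelled by the drift `-A E V^{p-1}`
because `A² ≥ (1 + η) E‖S‖²`. The second terms add up to a constant times
`l E V^{p-2}`, which is absorbed into `E V^p` at the price of `l^{p/2}`.

For the projector, `‖P ι_i z‖^p ≤ c_i ‖z‖^p`, where `ι_i` embeds the `i`-th block and the `c_i`,
the traces of the diagonal blocks of `P`, sum to `D`; moreover `l = E‖ε₁‖²` is admissible and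
`l^{p/2} ≤ E‖ε₁‖^p` by Jensen. The same inequality on the real line bounds `E |⟨u, ε⟩|^p` by
`C E‖ε₁‖^p` for a unit vector `u`.

Comparing the criterion at the selected model and at an oracle model bounds the loss by a multiple of
the oracle risk and of the positive parts, for these two models, of
`(1 + η)(‖P_m ε‖² + ⟨u_m, ε⟩²) - (1 + θ) δ_m² D_m`, with `u_m` the direction of the bias of the
model `m` (`norm_sub_proj_sq_le`). When `(1 + η)³ < 1 + θ`, such a remainder is at most
`c (V² + ⟨u_m, ε⟩²) - τ δ_m² D_m` with `τ > 0`, so the `q`-th power of its positive part is at most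
`c' (V^p + |⟨u_m, ε⟩|^p) (τ δ_m² D_m)^{q - p/2}`, whose expectation is at most a constant times
`E‖ε₁‖^p δ_m^{2q - p} D_m^{1 + q - p/2}` (`exists_integral_remainder_le`). Summing over the models
gives the claim.
-/

namespace MultiReg

/-! ### Pointwise inequalities for the radial field `x ↦ (‖x‖ - A)₊^{p-1} x / ‖x‖` -/

theorem add_rpow_le_two_rpow_mul {s a b : ℝ} (hs : 0 ≤ s) (ha : 0 ≤ a) (hb : 0 ≤ b) :
    (a + b) ^ s ≤ 2 ^ s * (a ^ s + b ^ s) := by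
  have h2 : (0 : ℝ) ≤ 2 ^ s := by positivity
  have ha' : 0 ≤ a ^ s := by positivity
  have hb' : 0 ≤ b ^ s := by positivity
  rcases le_total a b with h | h
  · calc (a + b) ^ s ≤ (2 * b) ^ s := by gcongr; linarith
      _ = 2 ^ s * b ^ s := Real.mul_rpow (by norm_num) hb
      _ ≤ _ := by gcongr; linarith
  · calc (a + b) ^ s ≤ (2 * a) ^ s := by gcongr; linarith
      _ = 2 ^ s * a ^ s := Real.mul_rpow (by norm_num) ha
      _ ≤ _ := by gcongr; linarith

/-- The leading constant `1 + η` is what later allows the drift to absorb the main term. -/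
theorem exists_add_rpow_le {s η : ℝ} (hs : 0 < s) (hη : 0 < η) :
    ∃ C : ℝ, 0 ≤ C ∧ ∀ a b : ℝ, 0 ≤ a → 0 ≤ b →
      (a + b) ^ s ≤ (1 + η) * a ^ s + C * b ^ s := by
  set t : ℝ := (1 + η) ^ (1 / s) - 1 with ht
  have ht0 : 0 < t := by
    have : 1 < (1 + η) ^ (1 / s) := Real.one_lt_rpow (by linarith) (by positivity)
    linarith
  have hts : (1 + t) ^ s = 1 + η := by
    rw [ht, add_sub_cancel, ← Real.rpow_mul (by linarith), one_div_mul_cancel hs.ne',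
      Real.rpow_one]
  refine ⟨(1 / t + 1) ^ s, by positivity, fun a b ha hb => ?_⟩
  have ha' : 0 ≤ a ^ s := by positivity
  have hb' : 0 ≤ b ^ s := by positivity
  rcases le_total b (t * a) with h | h
  · calc (a + b) ^ s ≤ ((1 + t) * a) ^ s := by gcongr; linarith
      _ = (1 + η) * a ^ s := by rw [Real.mul_rpow (by linarith) ha, hts]
      _ ≤ _ := le_add_of_nonneg_right (by positivity)
  · have : a ≤ 1 / t * b := by rw [one_div, inv_mul_eq_div, le_div_iff₀ ht0]; linarith
    calc (a + b) ^ s ≤ ((1 / t + 1) * b) ^ s := by gcongr; linarith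
      _ = (1 / t + 1) ^ s * b ^ s := Real.mul_rpow (by positivity) hb
      _ ≤ _ := le_add_of_nonneg_left (by positivity)

/-- Convexity of `x ↦ x ^ k`: its graph lies above its tangents. -/
theorem rpow_tangent_le {k a b : ℝ} (hk : 1 < k) (ha : 0 ≤ a) (hb : 0 ≤ b) :
    a ^ k + k * a ^ (k - 1) * (b - a) ≤ b ^ k := by
  rcases ha.eq_or_lt with rfl | ha
  · rw [Real.zero_rpow (by linarith), Real.zero_rpow (by linarith)]
    simpa using Real.rpow_nonneg hb k
  · have h := one_add_mul_self_le_rpow_one_add (s := (b - a) / a) (p := k)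
      (by rw [le_div_iff₀ ha]; linarith) hk.le
    have e : 1 + (b - a) / a = b / a := by field_simp; ring
    rw [e, Real.div_rpow hb ha.le, le_div_iff₀ (by positivity)] at h
    have e2 : a ^ k = a ^ (k - 1) * a := by
      rw [← Real.rpow_add_one ha.ne']; ring_nf
    calc _ = (1 + k * ((b - a) / a)) * a ^ k := by rw [e2]; field_simp
      _ ≤ _ := h

theorem rpow_sub_two_mul_sq {x p : ℝ} (hx : 0 ≤ x) (hp : 2 < p) : x ^ (p - 2) * x ^ 2 = x ^ p := by
  rw [← Real.rpow_natCast x 2, ← Real.rpow_add_of_nonneg hx (by linarith) (by norm_num)]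
  norm_num

theorem rpow_sub_one_mul_self {x p : ℝ} (hx : 0 ≤ x) (hp : 1 < p) : x ^ (p - 1) * x = x ^ p := by
  have := Real.rpow_add_of_nonneg hx (show 0 ≤ p - 1 by linarith) zero_le_one
  rw [Real.rpow_one] at this
  rw [← this]; norm_num

theorem rpow_sub_two_mul_self {x p : ℝ} (hx : 0 ≤ x) (hp : 2 < p) :
    x ^ (p - 2) * x = x ^ (p - 1) := by
  have := rpow_sub_one_mul_self hx (show 1 < p - 1 by linarith)
  rwa [show p - 1 - 1 = p - 2 by ring] at this

/-- Young's inequality, absorbing the weak variance term `l V^{p-2}` into `V^p / 2`. -/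
theorem exists_mul_rpow_sub_two_le {p c : ℝ} (hp : 2 < p) (hc : 0 ≤ c) :
    ∃ C : ℝ, 0 ≤ C ∧ ∀ V l : ℝ, 0 ≤ V → 0 ≤ l →
      c * (V ^ (p - 2) * l) ≤ V ^ p / 2 + C * l ^ (p / 2) := by
  have hp2 : (0 : ℝ) ≤ p - 2 := by linarith
  refine ⟨c * (2 * c) ^ ((p - 2) / 2), by positivity, fun V l hV hl => ?_⟩
  -- the threshold is `V² = 2 c l`
  rcases le_total (2 * c * l) (V ^ 2) with h | h
  · have : V ^ (p - 2) * (2 * c * l) ≤ V ^ p := by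
      rw [← rpow_sub_two_mul_sq hV hp]; gcongr
    have h2 : 0 ≤ c * (2 * c) ^ ((p - 2) / 2) * l ^ (p / 2) := by positivity
    linarith
  · have e : V ^ (p - 2) = (V ^ 2) ^ ((p - 2) / 2) := by
      rw [← Real.rpow_natCast V 2, ← Real.rpow_mul hV]; norm_num; ring_nf
    have e2 : l ^ ((p - 2) / 2) * l = l ^ (p / 2) := by
      have := rpow_sub_one_mul_self hl (show 1 < p / 2 by linarith)
      rwa [show p / 2 - 1 = (p - 2) / 2 by ring] at this
    refine le_add_of_nonneg_of_le (by positivity) ?_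
    calc c * (V ^ (p - 2) * l) ≤ c * ((2 * c * l) ^ ((p - 2) / 2) * l) := by
          rw [e]; gcongr
      _ = c * (2 * c) ^ ((p - 2) / 2) * (l ^ ((p - 2) / 2) * l) := by
          rw [Real.mul_rpow (by positivity) hl]; ring
      _ = _ := by rw [e2]

/-- The amount `(r - A)₊` by which `r` exceeds the level `A`. -/
noncomputable def excess (A r : ℝ) : ℝ := max (r - A) 0

theorem excess_nonneg (A r : ℝ) : 0 ≤ excess A r := le_max_right _ _

theorem excess_le {A r : ℝ} (hA : 0 ≤ A) (hr : 0 ≤ r) : excess A r ≤ r :=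
  max_le (by linarith) hr

theorem excess_mono (A : ℝ) {r s : ℝ} (h : r ≤ s) : excess A r ≤ excess A s :=
  max_le_max (by linarith) le_rfl

theorem excess_le_add (A : ℝ) {r s b : ℝ} (hb : 0 ≤ b) (h : r ≤ s + b) :
    excess A r ≤ excess A s + b := by
  unfold excess
  refine max_le ?_ (by positivity)
  have := le_max_left (s - A) 0
  linarith

theorem excess_eq_zero_or (A r : ℝ) : excess A r = 0 ∨ (excess A r = r - A ∧ A < r) := by
  unfold excess
  rcases le_or_gt (r - A) 0 with h | h
  · exact Or.inl (max_eq_right h)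
  · exact Or.inr ⟨max_eq_left h.le, by linarith⟩

/-- The radial weight `(r - A)₊^{p-1} / r`. The field `x ↦ radialWeight A p ‖x‖ • x` is the gradient
of `x ↦ (‖x‖ - A)₊^p / p`. -/
noncomputable def radialWeight (A p r : ℝ) : ℝ := excess A r ^ (p - 1) / r

theorem radialWeight_sub_le {A p r s : ℝ} (hp : 2 < p) (hA : 0 < A) (hr : 0 ≤ r)
    (hrs : r ≤ s) :
    |radialWeight A p s - radialWeight A p r| ≤ (p - 1) * excess A s ^ (p - 2) * (s - r) / s := by
  have hs : 0 ≤ s := hr.trans hrs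
  have hV := excess_nonneg A r
  have hW := excess_nonneg A s
  have hVW := excess_mono A hrs
  rcases excess_eq_zero_or A r with h0 | ⟨h0, h1⟩
  · have e : radialWeight A p r = 0 := by
      rw [radialWeight, h0, Real.zero_rpow (by linarith), zero_div]
    have hle : excess A s ≤ s - r := by
      have : r - A ≤ excess A r := le_max_left _ _
      exact max_le (by linarith) (by linarith)
    rw [e, sub_zero, abs_of_nonneg (by unfold radialWeight; positivity), radialWeight,
      ← rpow_sub_two_mul_self hW hp]
    have : 0 ≤ excess A s ^ (p - 2) := by positivity
    have : excess A s ^ (p - 2) ≤ (p - 1) * excess A s ^ (p - 2) := by nlinarith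
    have : 0 ≤ (p - 1) * excess A s ^ (p - 2) := by linarith
    gcongr
  · have hr0 : 0 < r := hA.trans h1
    have hs0 : 0 < s := hr0.trans_le hrs
    have hWs : excess A s = s - A := by
      rcases excess_eq_zero_or A s with h2 | h2
      · linarith
      · exact h2.1
    have hmono : radialWeight A p r ≤ radialWeight A p s := by
      rw [radialWeight, radialWeight, ← rpow_sub_two_mul_self hV hp, ← rpow_sub_two_mul_self hW hp,
        mul_div_assoc, mul_div_assoc]
      have : excess A r / r ≤ excess A s / s := by
        rw [h0, hWs, div_le_div_iff₀ hr0 hs0]; nlinarith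
      gcongr
    rw [abs_of_nonneg (by linarith), mul_div_assoc]
    have h2 := rpow_tangent_le (k := p - 1) (by linarith) hW hV
    rw [show p - 1 - 1 = p - 2 by ring, show excess A r - excess A s = -(s - r) by
      rw [h0, hWs]; ring] at h2
    have h3 : excess A r ^ (p - 1) / s ≤ radialWeight A p r := by
      rw [radialWeight]; gcongr
    calc radialWeight A p s - radialWeight A p r
        ≤ excess A s ^ (p - 1) / s - excess A r ^ (p - 1) / s := by
          have : radialWeight A p s = excess A s ^ (p - 1) / s := rfl
          linarith
      _ = (excess A s ^ (p - 1) - excess A r ^ (p - 1)) / s := by ring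
      _ ≤ ((p - 1) * excess A s ^ (p - 2) * (s - r)) / s := by gcongr; linarith
      _ = _ := by ring

/-- Lipschitz bound for the radial weight in terms of squared radii. Dividing by the larger radius
keeps the estimate free of singularities at the origin. -/
theorem abs_radialWeight_sub_le {A p r s : ℝ} (hp : 2 < p) (hA : 0 < A) (hr : 0 ≤ r)
    (hs : 0 ≤ s) :
    |radialWeight A p s - radialWeight A p r| ≤
      (p - 1) * excess A (max r s) ^ (p - 2) * (|s ^ 2 - r ^ 2| / max r s ^ 2) := by
  have key : ∀ r s : ℝ, 0 ≤ r → r ≤ s →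
      |radialWeight A p s - radialWeight A p r| ≤
      (p - 1) * excess A s ^ (p - 2) * (|s ^ 2 - r ^ 2| / s ^ 2) := by
    intro r s hr hrs
    rcases (hr.trans hrs).eq_or_lt with h0 | h0
    · have : r = 0 := by linarith
      subst this; subst h0; simp
    refine (radialWeight_sub_le hp hA hr hrs).trans ?_
    have hW := excess_nonneg A s
    have : 0 ≤ (p - 1) * excess A s ^ (p - 2) := mul_nonneg (by linarith) (by positivity)
    rw [mul_div_assoc]
    refine mul_le_mul_of_nonneg_left ?_ this
    rw [abs_of_nonneg (by nlinarith), div_le_div_iff₀ h0 (by positivity)]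
    nlinarith [mul_nonneg (mul_nonneg h0.le hr) (sub_nonneg.2 hrs)]
  rcases le_total r s with h | h
  · rw [max_eq_right h]; exact key r s hr h
  · rw [max_eq_left h, abs_sub_comm, abs_sub_comm (s ^ 2)]; exact key s r hs h

/-- The second-order error terms, quartic in the increment `B`, are negligible: they are dominated
by a small multiple of the drift term plus `B ^ p`. -/
theorem exists_quartic_le {p η : ℝ} (hp : 2 < p) (hη : 0 < η) :
    ∃ C : ℝ, 0 ≤ C ∧ ∀ A V r B : ℝ, 0 < A → 0 ≤ V → V ≤ r → 0 ≤ B → B ≤ r → (0 < V → A ≤ r) →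
      V ^ (p - 2) * (B ^ 4 / r ^ 2) ≤ η * (V ^ (p - 1) * B ^ 2 / A) + C * B ^ p := by
  refine ⟨(1 / η) ^ (p - 2), by positivity, fun A V r B hA hV hVr hB hBr hAr => ?_⟩
  have hp2 : (0 : ℝ) ≤ p - 2 := by linarith
  rcases hV.eq_or_lt with h0 | h0
  · subst h0
    rw [Real.zero_rpow (by linarith), Real.zero_rpow (by linarith)]
    simp only [zero_mul, zero_div, mul_zero, zero_add]
    positivity
  have hAr := hAr h0
  have hr : 0 < r := by linarith
  -- either `B² / r ≤ η V` and one power of `V` is gained, or `V < B² / (η r) ≤ B / η`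
  rcases le_total (B ^ 2) (η * V * r) with h | h
  · refine le_add_of_le_of_nonneg ?_ (by positivity)
    calc V ^ (p - 2) * (B ^ 4 / r ^ 2) = V ^ (p - 2) * (B ^ 2 * B ^ 2 / r ^ 2) := by ring
      _ ≤ V ^ (p - 2) * (η * V * r * B ^ 2 / r ^ 2) := by gcongr
      _ = η * (V ^ (p - 2) * V * B ^ 2 / r) := by field_simp
      _ = η * (V ^ (p - 1) * B ^ 2 / r) := by rw [rpow_sub_two_mul_self hV hp]
      _ ≤ _ := by gcongr
  · refine le_add_of_nonneg_of_le (by positivity) ?_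
    have h1 : V ≤ 1 / η * B := by
      rw [one_div, inv_mul_eq_div, le_div_iff₀ hη]
      have : V * η * r ≤ B * r := by nlinarith
      exact le_of_mul_le_mul_right this hr
    calc V ^ (p - 2) * (B ^ 4 / r ^ 2) ≤ (1 / η * B) ^ (p - 2) * B ^ 2 := by
          gcongr
          rw [div_le_iff₀ (by positivity)]
          have : B ^ 2 ≤ r ^ 2 := by gcongr
          nlinarith [sq_nonneg B]
      _ = (1 / η) ^ (p - 2) * (B ^ (p - 2) * B ^ 2) := by
          rw [Real.mul_rpow (by positivity) hB]; ring
      _ = _ := by rw [rpow_sub_two_mul_sq hB hp]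

variable {H : Type*} [NormedAddCommGroup H] [InnerProductSpace ℝ H]

/-- The vector field `x ↦ (‖x‖ - A)₊^{p-1} x / ‖x‖`. -/
noncomputable def radialField (A p : ℝ) (x : H) : H := radialWeight A p ‖x‖ • x

theorem inner_direction_sq_le (x z : H) : inner ℝ (‖x‖⁻¹ • x) z ^ 2 ≤ ‖z‖ ^ 2 := by
  rw [← sq_abs]
  gcongr
  refine (abs_real_inner_le_norm _ _).trans ?_
  have : ‖‖x‖⁻¹ • x‖ ≤ 1 := by
    rw [norm_smul, norm_inv, norm_norm]; exact inv_mul_le_one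
  nlinarith [norm_nonneg z]

/-- The form in which a small excess `V ≤ b` is traded for the `p`-th power of the increment. -/
theorem norm_rpow_le_of_le {p : ℝ} (hp : 2 < p) {V b c : ℝ} (hV : 0 ≤ V) (h : V ≤ b)
    (hc : 0 ≤ c) (hcb : c ≤ b) : V ^ (p - 2) * c ^ 2 ≤ b ^ p := by
  rw [← rpow_sub_two_mul_sq (hV.trans h) hp]
  have : 0 ≤ p - 2 := by linarith
  have : 0 ≤ b := hV.trans h
  gcongr

/-- The term of the increment of the field that comes from the increment `z` itself, `b = ‖z‖`; here
`r = ‖x‖` and `s = ‖x + z‖`. -/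
theorem exists_radialWeight_mul_sq_le {p η : ℝ} (hp : 2 < p) (hη : 0 < η) :
    ∃ C : ℝ, 0 ≤ C ∧ ∀ A r s b : ℝ, 0 < A → 0 ≤ s → 0 ≤ b → s ≤ r + b →
      radialWeight A p s * b ^ 2 ≤
        (1 + η) * (excess A r ^ (p - 1) * b ^ 2 / A) + C * b ^ p := by
  have hp1 : (0 : ℝ) < p - 1 := by linarith
  obtain ⟨C₁, hC₁, h₁⟩ := exists_add_rpow_le (s := p - 1) hp1 hη
  refine ⟨C₁ + 1, by positivity, fun A r s b hA hs0 hb0 hsr => ?_⟩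
  have hV0 : 0 ≤ excess A r := excess_nonneg _ _
  set V := excess A r with hVd
  have hW := excess_nonneg A s
  have hWV : excess A s ≤ V + b := excess_le_add A hb0 hsr
  have hbp : 0 ≤ b ^ p := by positivity
  rcases excess_eq_zero_or A s with h0 | ⟨h0, hAs⟩
  · rw [radialWeight, h0, Real.zero_rpow hp1.ne', zero_div, zero_mul]
    positivity
  have hs0' : 0 < s := hA.trans hAs
  rcases le_total b s with hbs | hbs
  · have e : b ^ (p - 1) * b ^ 2 / s ≤ b ^ p := by
      rw [div_le_iff₀ hs0', ← rpow_sub_one_mul_self hb0 (show 1 < p by linarith)]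
      have : 0 ≤ b ^ (p - 1) := by positivity
      calc b ^ (p - 1) * b ^ 2 = b ^ (p - 1) * b * b := by ring
        _ ≤ _ := by gcongr
    calc radialWeight A p s * b ^ 2 = excess A s ^ (p - 1) * b ^ 2 / s := by
          rw [radialWeight]; ring
      _ ≤ (V + b) ^ (p - 1) * b ^ 2 / s := by gcongr
      _ ≤ ((1 + η) * V ^ (p - 1) + C₁ * b ^ (p - 1)) * b ^ 2 / s := by
          gcongr; exact h₁ V b hV0 hb0
      _ = (1 + η) * (V ^ (p - 1) * b ^ 2 / s) + C₁ * (b ^ (p - 1) * b ^ 2 / s) := by ring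
      _ ≤ (1 + η) * (V ^ (p - 1) * b ^ 2 / A) + C₁ * b ^ p := by gcongr
      _ ≤ _ := by linarith
  · have : radialWeight A p s * b ^ 2 ≤ b ^ p := by
      have hWs : excess A s ≤ s := excess_le hA.le hs0
      have : radialWeight A p s ≤ excess A s ^ (p - 2) := by
        rw [radialWeight, div_le_iff₀ hs0', ← rpow_sub_two_mul_self hW hp]
        gcongr
      calc radialWeight A p s * b ^ 2 ≤ excess A s ^ (p - 2) * b ^ 2 := by gcongr
        _ ≤ b ^ p := norm_rpow_le_of_le hp hW (hWs.trans hbs) hb0 le_rfl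
    have h1 : 0 ≤ (1 + η) * (V ^ (p - 1) * b ^ 2 / A) := by positivity
    have h2 : 0 ≤ C₁ * b ^ p := by positivity
    linarith

theorem radialWeight_sub_mul_le {A p r s b i : ℝ} (hp : 2 < p) (hA : 0 < A) (hr0 : 0 ≤ r)
    (hs0 : 0 ≤ s) (hb0 : 0 ≤ b) (hsr : s ≤ r + b) (hs2 : s ^ 2 - r ^ 2 = 2 * i + b ^ 2) :
    (radialWeight A p s - radialWeight A p r) * i ≤
      (p - 1) * 2 ^ (p - 2) * ((excess A r ^ (p - 2) + b ^ (p - 2)) *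
        ((2 * |i| + b ^ 2) * |i| / max r s ^ 2)) := by
  have hp1 : (0 : ℝ) < p - 1 := by linarith
  have hp2 : (0 : ℝ) < p - 2 := by linarith
  set V := excess A r with hVd
  set m := max r s with hm
  have hV0 : 0 ≤ V := excess_nonneg _ _
  have hW : excess A m ≤ V + b := excess_le_add A hb0 (max_le (by linarith) hsr)
  have hW0 := excess_nonneg A m
  calc (radialWeight A p s - radialWeight A p r) * i
      ≤ |radialWeight A p s - radialWeight A p r| * |i| := by
        rw [← abs_mul]; exact le_abs_self _
    _ ≤ ((p - 1) * excess A m ^ (p - 2) * (|s ^ 2 - r ^ 2| / m ^ 2)) * |i| := by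
        gcongr; exact abs_radialWeight_sub_le hp hA hr0 hs0
    _ ≤ ((p - 1) * (V + b) ^ (p - 2) * ((2 * |i| + b ^ 2) / m ^ 2)) * |i| := by
        gcongr
        rw [hs2]
        refine (abs_add_le _ _).trans ?_
        rw [abs_mul, abs_two, abs_of_nonneg (sq_nonneg b)]
    _ = (p - 1) * (V + b) ^ (p - 2) * ((2 * |i| + b ^ 2) * |i| / m ^ 2) := by ring
    _ ≤ (p - 1) * (2 ^ (p - 2) * (V ^ (p - 2) + b ^ (p - 2))) *
          ((2 * |i| + b ^ 2) * |i| / m ^ 2) := by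
        gcongr; exact add_rpow_le_two_rpow_mul hp2.le hV0 hb0
    _ = _ := by ring

/-- The term of the increment of the field that comes from the variation of the radial weight; here
`r = ‖x‖`, `s = ‖x + z‖`, `b = ‖z‖` and `i = ⟨x, z⟩`. -/
theorem exists_radialWeight_sub_mul_le {p η : ℝ} (hp : 2 < p) (hη : 0 < η) :
    ∃ C : ℝ, 0 ≤ C ∧ ∀ A r s b i : ℝ, 0 < A → 0 ≤ r → 0 ≤ s → 0 ≤ b → s ≤ r + b → b ≤ s + r →
      |i| ≤ r * b → s ^ 2 - r ^ 2 = 2 * i + b ^ 2 →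
      (radialWeight A p s - radialWeight A p r) * i ≤
        η * (excess A r ^ (p - 1) * b ^ 2 / A) + C * (excess A r ^ (p - 2) * (i / r) ^ 2)
          + C * b ^ p := by
  set K : ℝ := (p - 1) * 2 ^ (p - 2) with hK
  have hp1 : (0 : ℝ) < p - 1 := by linarith
  have hp2 : (0 : ℝ) < p - 2 := by linarith
  have hK0 : 0 < K := by positivity
  obtain ⟨C₂, hC₂, h₂⟩ := exists_quartic_le (p := p) (η := η / K) hp (by positivity)
  refine ⟨K * (C₂ + 9), by positivity, fun A r s b i hA hr0 hs0 hb0 hsr hbs hirb hs2 => ?_⟩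
  refine (radialWeight_sub_mul_le hp hA hr0 hs0 hb0 hsr hs2).trans ?_
  rw [← hK]
  set V := excess A r with hVd
  set m := max r s with hm
  have hrm : r ≤ m := le_max_left _ _
  have hsm : s ≤ m := le_max_right _ _
  have hV0 : 0 ≤ V := excess_nonneg _ _
  have hVr : V ≤ r := excess_le hA.le hr0
  have hm0 : 0 ≤ m := hr0.trans hrm
  set Q := (2 * |i| + b ^ 2) * |i| / m ^ 2 with hQ
  have hQ0 : 0 ≤ Q := by positivity
  have him : |i| ≤ m * b := hirb.trans (by gcongr)
  have hQ1 : Q ≤ 4 * b ^ 2 := by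
    refine div_le_of_le_mul₀ (by positivity) (by positivity) ?_
    have hbm : b ^ 2 ≤ b * (2 * m) := by
      rw [sq]; gcongr; linarith
    calc (2 * |i| + b ^ 2) * |i| ≤ (2 * (m * b) + b * (2 * m)) * (m * b) := by gcongr
      _ = 4 * b ^ 2 * m ^ 2 := by ring
  have hb' : b ^ (p - 2) * Q ≤ 4 * b ^ p := by
    calc b ^ (p - 2) * Q ≤ b ^ (p - 2) * (4 * b ^ 2) := by gcongr
      _ = 4 * (b ^ (p - 2) * b ^ 2) := by ring
      _ = _ := by rw [rpow_sub_two_mul_sq hb0 hp]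
  have hbp : 0 ≤ b ^ p := by positivity
  have hA2 : 0 ≤ V ^ (p - 2) * (i / r) ^ 2 := by positivity
  have hVQ : V ^ (p - 2) * Q ≤ η / K * (V ^ (p - 1) * b ^ 2 / A)
      + 9 * (V ^ (p - 2) * (i / r) ^ 2) + (C₂ + 5) * b ^ p := by
    have hA1 : 0 ≤ η / K * (V ^ (p - 1) * b ^ 2 / A) := by positivity
    have hA3 : 0 ≤ C₂ * b ^ p := by positivity
    rcases le_total b r with hbr | hbr
    · rcases hr0.eq_or_lt with h0 | h0
      · have : b = 0 := by linarith
        have : Q = 0 := le_antisymm (by rw [this] at hQ1; simpa using hQ1) hQ0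
        rw [this, mul_zero]
        positivity
      · have hQ2 : Q ≤ 3 * (i / r) ^ 2 + b ^ 4 / r ^ 2 := by
          have n1 : (2 * |i| + b ^ 2) * |i| ≤ 3 * i ^ 2 + b ^ 4 := by
            rw [← sq_abs i]
            nlinarith [sq_nonneg (|i| - b ^ 2), sq_nonneg (b ^ 2), abs_nonneg i]
          calc Q ≤ (3 * i ^ 2 + b ^ 4) / m ^ 2 := by rw [hQ]; gcongr
            _ ≤ (3 * i ^ 2 + b ^ 4) / r ^ 2 := by gcongr
            _ = _ := by field_simp
        have h3 := h₂ A V r b hA hV0 hVr hb0 hbr (by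
          intro hV
          rcases excess_eq_zero_or A r with h | h
          · rw [hVd, h] at hV; exact absurd hV (lt_irrefl _)
          · exact h.2.le)
        calc V ^ (p - 2) * Q ≤ V ^ (p - 2) * (3 * (i / r) ^ 2 + b ^ 4 / r ^ 2) := by gcongr
          _ = 3 * (V ^ (p - 2) * (i / r) ^ 2) + V ^ (p - 2) * (b ^ 4 / r ^ 2) := by ring
          _ ≤ _ := by linarith
    · have : V ^ (p - 2) * Q ≤ 4 * b ^ p := by
        calc V ^ (p - 2) * Q ≤ V ^ (p - 2) * (4 * b ^ 2) := by gcongr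
          _ = 4 * (V ^ (p - 2) * b ^ 2) := by ring
          _ ≤ _ := by
            gcongr
            exact norm_rpow_le_of_le hp hV0 (hVr.trans hbr) hb0 le_rfl
      linarith
  calc K * ((V ^ (p - 2) + b ^ (p - 2)) * Q) = K * (V ^ (p - 2) * Q + b ^ (p - 2) * Q) := by ring
    _ ≤ K * ((η / K * (V ^ (p - 1) * b ^ 2 / A)
      + 9 * (V ^ (p - 2) * (i / r) ^ 2) + (C₂ + 5) * b ^ p) + 4 * b ^ p) := by gcongr
    _ = η * (V ^ (p - 1) * b ^ 2 / A) + K * 9 * (V ^ (p - 2) * (i / r) ^ 2)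
        + K * (C₂ + 9) * b ^ p := by field_simp; ring
    _ ≤ _ := by gcongr; linarith

/-- Second-order bound for the increment of the field from `x` to `x + z`, tested against `z`. -/
theorem exists_inner_radialField_sub_le {p η : ℝ} (hp : 2 < p) (hη : 0 < η) :
    ∃ C : ℝ, 0 ≤ C ∧ ∀ (H : Type*) [NormedAddCommGroup H] [InnerProductSpace ℝ H],
      ∀ A : ℝ, 0 < A → ∀ x z : H,
      inner ℝ z (radialField A p (x + z) - radialField A p x) ≤
        (1 + η) * (excess A ‖x‖ ^ (p - 1) * ‖z‖ ^ 2 / A)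
          + C * (excess A ‖x‖ ^ (p - 2) * inner ℝ (‖x‖⁻¹ • x) z ^ 2) + C * ‖z‖ ^ p := by
  obtain ⟨C₁, hC₁, h₁⟩ := exists_radialWeight_mul_sq_le hp (half_pos hη)
  obtain ⟨C₂, hC₂, h₂⟩ := exists_radialWeight_sub_mul_le hp (half_pos hη)
  refine ⟨C₁ + C₂, by positivity, fun H _ _ A hA x z => ?_⟩
  have hexp : inner ℝ z (radialField A p (x + z) - radialField A p x) =
      radialWeight A p ‖x + z‖ * ‖z‖ ^ 2
        + (radialWeight A p ‖x + z‖ - radialWeight A p ‖x‖) * inner ℝ x z := by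
    simp only [radialField, inner_sub_right, inner_smul_right, inner_add_right,
      real_inner_self_eq_norm_sq, real_inner_comm x z]
    ring
  have hj : inner ℝ (‖x‖⁻¹ • x) z = inner ℝ x z / ‖x‖ := by
    rw [real_inner_smul_left]; ring
  have t1 := h₁ A ‖x‖ ‖x + z‖ ‖z‖ hA (norm_nonneg _) (norm_nonneg _) (norm_add_le _ _)
  have t2 := h₂ A ‖x‖ ‖x + z‖ ‖z‖ (inner ℝ x z) hA (norm_nonneg _) (norm_nonneg _) (norm_nonneg _)
    (norm_add_le _ _) (by simpa using norm_sub_le (x + z) x) (abs_real_inner_le_norm _ _)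
    (by rw [norm_add_sq_real]; ring)
  have : 0 ≤ C₁ * (excess A ‖x‖ ^ (p - 2) * (inner ℝ x z / ‖x‖) ^ 2) := by
    have := excess_nonneg A ‖x‖
    positivity
  rw [hexp, hj]
  linarith

theorem norm_direction_sub_le {x z : H} (hx : x ≠ 0) (hxz : x + z ≠ 0) :
    ‖‖x‖⁻¹ • x - ‖x + z‖⁻¹ • (x + z)‖ ≤ 2 * ‖z‖ / ‖x‖ := by
  have h1 : 0 < ‖x‖ := norm_pos_iff.2 hx
  have h2 : 0 < ‖x + z‖ := norm_pos_iff.2 hxz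
  have e : ‖x‖⁻¹ • x - ‖x + z‖⁻¹ • (x + z) =
      ‖x‖⁻¹ • (((‖x + z‖ - ‖x‖) * ‖x + z‖⁻¹) • (x + z) - z) := by
    rw [sub_mul, mul_inv_cancel₀ h2.ne', sub_smul, one_smul, smul_sub, smul_sub, smul_smul,
      ← mul_assoc, inv_mul_cancel₀ h1.ne', one_mul, smul_add ‖x‖⁻¹]
    abel
  rw [e, norm_smul, norm_inv, norm_norm, inv_mul_eq_div]
  gcongr
  refine (norm_sub_le _ _).trans ?_
  rw [norm_smul, norm_mul, norm_inv, norm_norm, mul_assoc, inv_mul_cancel₀ h2.ne', mul_one]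
  have : ‖‖x + z‖ - ‖x‖‖ ≤ ‖z‖ := by
    simpa using abs_norm_sub_norm_le (x + z) x
  linarith

/-- The directional variance term is moved from the point `x` to `x + y`. With `x = S - X_i` and
`y = X_i` it becomes a term at the full sum `S`, where the contributions of all `i` can be added up
to a weak variance. -/
theorem exists_direction_transfer_le {p η : ℝ} (hp : 2 < p) (hη : 0 < η) :
    ∃ C : ℝ, 0 ≤ C ∧ ∀ (H : Type*) [NormedAddCommGroup H] [InnerProductSpace ℝ H],
      ∀ A : ℝ, 0 < A → ∀ x y z : H,
      excess A ‖x‖ ^ (p - 2) * inner ℝ (‖x‖⁻¹ • x) z ^ 2 ≤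
        C * (excess A ‖x + y‖ ^ (p - 2) * inner ℝ (‖x + y‖⁻¹ • (x + y)) z ^ 2)
          + η * (excess A ‖x‖ ^ (p - 1) * (‖y‖ + ‖z‖) ^ 2 / A) + C * (‖y‖ + ‖z‖) ^ p := by
  have hp1 : (0 : ℝ) < p - 1 := by linarith
  have hp2 : (0 : ℝ) < p - 2 := by linarith
  obtain ⟨C₂, hC₂, h₂⟩ := exists_quartic_le (p := p) (η := η / 8) hp (by positivity)
  set K : ℝ := 2 * 2 ^ (p - 2) with hK
  have hK0 : 0 < K := by positivity
  refine ⟨K + 8 * C₂ + 1, by positivity, fun H _ _ A hA x y z => ?_⟩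
  set V := excess A ‖x‖ with hVd
  set W := excess A ‖x + y‖ with hWd
  set r := ‖x‖ with hr
  set a := ‖y‖ with ha
  set b := ‖z‖ with hb
  set B := a + b with hB
  set j := inner ℝ (r⁻¹ • x) z with hj
  set k := inner ℝ (‖x + y‖⁻¹ • (x + y)) z with hk
  have hr0 : 0 ≤ r := norm_nonneg _
  have ha0 : 0 ≤ a := norm_nonneg _
  have hb0 : 0 ≤ b := norm_nonneg _
  have hB0 : 0 ≤ B := by positivity
  have hV0 : 0 ≤ V := excess_nonneg _ _
  have hW0 : 0 ≤ W := excess_nonneg _ _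
  have hVr : V ≤ r := excess_le hA.le hr0
  have hj2 : j ^ 2 ≤ b ^ 2 := inner_direction_sq_le x z
  have hk2 : k ^ 2 ≤ b ^ 2 := inner_direction_sq_le (x + y) z
  have hBp : 0 ≤ B ^ p := by positivity
  have hWk : 0 ≤ W ^ (p - 2) * k ^ 2 := by positivity
  have hVA : 0 ≤ V ^ (p - 1) * B ^ 2 / A := by positivity
  rcases le_or_gt r B with h | h
  · have : V ^ (p - 2) * j ^ 2 ≤ B ^ p := by
      calc V ^ (p - 2) * j ^ 2 ≤ V ^ (p - 2) * b ^ 2 := by gcongr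
        _ ≤ _ := norm_rpow_le_of_le hp hV0 (hVr.trans h) hb0 (by linarith)
    have h1 : 0 ≤ (K + 8 * C₂ + 1) * (W ^ (p - 2) * k ^ 2) := by positivity
    have h2 : 0 ≤ η * (V ^ (p - 1) * B ^ 2 / A) := by positivity
    have h3 : 0 ≤ (K + 8 * C₂) * B ^ p := by positivity
    linarith
  · have hr1 : 0 < r := hB0.trans_lt h
    have hx : x ≠ 0 := norm_pos_iff.1 hr1
    have hxy : x + y ≠ 0 := by
      intro h0
      have : r = a := by rw [hr, ha, eq_neg_of_add_eq_zero_left h0, norm_neg]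
      linarith
    have hjk : |j - k| ≤ 2 * a / r * b := by
      rw [hj, hk, ← inner_sub_left]
      refine (abs_real_inner_le_norm _ _).trans ?_
      gcongr
      exact norm_direction_sub_le hx hxy
    have hjk2 : (j - k) ^ 2 ≤ 4 * (B ^ 4 / r ^ 2) := by
      rw [← sq_abs]
      calc |j - k| ^ 2 ≤ (2 * a / r * b) ^ 2 := by gcongr
        _ ≤ (2 * B / r * B) ^ 2 := by gcongr <;> linarith
        _ = _ := by ring
    have hj3 : j ^ 2 ≤ 2 * k ^ 2 + 8 * (B ^ 4 / r ^ 2) := by nlinarith [sq_nonneg (j - 2 * k)]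
    have hVW : V ≤ W + a := by
      refine excess_le_add A ha0 ?_
      calc r = ‖(x + y) - y‖ := by rw [add_sub_cancel_right]
        _ ≤ _ := norm_sub_le _ _
    have hV2 : V ^ (p - 2) ≤ 2 ^ (p - 2) * (W ^ (p - 2) + a ^ (p - 2)) :=
      (Real.rpow_le_rpow hV0 hVW hp2.le).trans (add_rpow_le_two_rpow_mul hp2.le hW0 ha0)
    have h3 := h₂ A V r B hA hV0 hVr hB0 h.le (by
            intro hV
            rcases excess_eq_zero_or A r with h | h
            · rw [hVd, h] at hV; exact absurd hV (lt_irrefl _)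
            · exact h.2.le)
    have h4 : a ^ (p - 2) * k ^ 2 ≤ B ^ p := by
      calc a ^ (p - 2) * k ^ 2 ≤ a ^ (p - 2) * b ^ 2 := by gcongr
        _ ≤ _ := norm_rpow_le_of_le hp ha0 (by linarith) hb0 (by linarith)
    calc V ^ (p - 2) * j ^ 2 ≤ V ^ (p - 2) * (2 * k ^ 2 + 8 * (B ^ 4 / r ^ 2)) := by gcongr
      _ = 2 * V ^ (p - 2) * k ^ 2 + 8 * (V ^ (p - 2) * (B ^ 4 / r ^ 2)) := by ring
      _ ≤ 2 * (2 ^ (p - 2) * (W ^ (p - 2) + a ^ (p - 2))) * k ^ 2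
          + 8 * (η / 8 * (V ^ (p - 1) * B ^ 2 / A) + C₂ * B ^ p) := by gcongr
      _ = K * (W ^ (p - 2) * k ^ 2) + K * (a ^ (p - 2) * k ^ 2)
          + η * (V ^ (p - 1) * B ^ 2 / A) + 8 * C₂ * B ^ p := by rw [hK]; ring
      _ ≤ K * (W ^ (p - 2) * k ^ 2) + K * B ^ p
          + η * (V ^ (p - 1) * B ^ 2 / A) + 8 * C₂ * B ^ p := by gcongr
      _ ≤ _ := by nlinarith [mul_nonneg hC₂ hWk]

/-- The increment bound used for the summand `X_i`: `x` is the sum of the others, `y = X_i`, and `z`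
an independent copy of `X_i`. The constant does not depend on the space. -/
theorem exists_decoupled_increment_le {p η : ℝ} (hp : 2 < p) (hη : 0 < η) :
    ∃ C : ℝ, 0 ≤ C ∧ ∀ (H : Type*) [NormedAddCommGroup H] [InnerProductSpace ℝ H],
      ∀ A : ℝ, 0 < A → ∀ x y z : H,
      inner ℝ z (radialField A p (x + z)) - inner ℝ z (radialField A p x) ≤
        (1 + η) * (excess A ‖x‖ ^ (p - 1) * ‖z‖ ^ 2 / A)
          + η * (excess A ‖x‖ ^ (p - 1) * ‖y‖ ^ 2 / A)
          + C * (excess A ‖x + y‖ ^ (p - 2) * inner ℝ (‖x + y‖⁻¹ • (x + y)) z ^ 2)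
          + C * (‖y‖ ^ p + ‖z‖ ^ p) := by
  obtain ⟨C₁, hC₁, h₁⟩ := exists_inner_radialField_sub_le (p := p) (η := η / 2) hp
    (by positivity)
  obtain ⟨C₂, hC₂, h₂⟩ := exists_direction_transfer_le (p := p)
    (η := η / (4 * (C₁ + 1))) hp (by positivity)
  have h2p : (0 : ℝ) < 2 ^ p := by positivity
  refine ⟨C₁ * C₂ + C₁ + C₁ * C₂ * 2 ^ p, by positivity, fun H _ _ A hA x y z => ?_⟩
  have i1 := h₁ H A hA x z
  have i2 := h₂ H A hA x y z
  rw [inner_sub_right] at i1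
  set V := excess A ‖x‖ with hVd
  set W := excess A ‖x + y‖ with hWd
  set T := excess A ‖x + y‖ ^ (p - 2) * inner ℝ (‖x + y‖⁻¹ • (x + y)) z ^ 2
  set a := ‖y‖ with ha
  set b := ‖z‖ with hb
  have ha0 : 0 ≤ a := norm_nonneg _
  have hb0 : 0 ≤ b := norm_nonneg _
  have hV0 : 0 ≤ V := excess_nonneg _ _
  have hW0 : 0 ≤ W := excess_nonneg _ _
  have hT : 0 ≤ T := by positivity
  have i3 : (a + b) ^ p ≤ 2 ^ p * (a ^ p + b ^ p) := add_rpow_le_two_rpow_mul (by linarith) ha0 hb0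
  have i4 : V ^ (p - 1) * (a + b) ^ 2 / A ≤
      2 * (V ^ (p - 1) * a ^ 2 / A) + 2 * (V ^ (p - 1) * b ^ 2 / A) := by
    calc V ^ (p - 1) * (a + b) ^ 2 / A ≤ V ^ (p - 1) * (2 * a ^ 2 + 2 * b ^ 2) / A := by
          gcongr; nlinarith [sq_nonneg (a - b)]
      _ = _ := by ring
  set Y := V ^ (p - 1) * a ^ 2 / A with hY
  set Z := V ^ (p - 1) * b ^ 2 / A with hZ
  have hY0 : 0 ≤ Y := by positivity
  have hZ0 : 0 ≤ Z := by positivity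
  have hap : 0 ≤ a ^ p := by positivity
  have hbp : 0 ≤ b ^ p := by positivity
  have hc : C₁ * (η / (4 * (C₁ + 1))) ≤ η / 4 := by
    rw [mul_div_assoc', div_le_div_iff₀ (by positivity) (by norm_num)]
    nlinarith
  calc _ ≤ _ := i1
    _ ≤ (1 + η / 2) * Z + C₁ * (C₂ * T + η / (4 * (C₁ + 1)) * (2 * Y + 2 * Z)
          + C₂ * (2 ^ p * (a ^ p + b ^ p))) + C₁ * b ^ p := by
        gcongr
        refine i2.trans ?_
        gcongr
    _ = (1 + η / 2) * Z + C₁ * C₂ * T + C₁ * (η / (4 * (C₁ + 1))) * (2 * Y + 2 * Z)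
          + C₁ * C₂ * 2 ^ p * (a ^ p + b ^ p) + C₁ * b ^ p := by ring
    _ ≤ (1 + η / 2) * Z + C₁ * C₂ * T + η / 4 * (2 * Y + 2 * Z)
          + C₁ * C₂ * 2 ^ p * (a ^ p + b ^ p) + C₁ * b ^ p := by gcongr
    _ = (1 + η) * Z + η / 2 * Y + C₁ * C₂ * T
          + C₁ * C₂ * 2 ^ p * (a ^ p + b ^ p) + C₁ * b ^ p := by ring
    _ ≤ (1 + η) * Z + η * Y + (C₁ * C₂ + C₁ + C₁ * C₂ * 2 ^ p) * T
          + (C₁ * C₂ + C₁ + C₁ * C₂ * 2 ^ p) * (a ^ p + b ^ p) := by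
        have e1 : 0 ≤ (C₁ + C₁ * C₂ * 2 ^ p) * T := by positivity
        have e2 : 0 ≤ C₁ * C₂ * (a ^ p + b ^ p) := by positivity
        have e3 : 0 ≤ C₁ * a ^ p := by positivity
        have e4 : 0 ≤ η / 2 * Y := by positivity
        linarith

/-- `x ↦ (‖x‖ - A)₊^{p-1}` lies above its tangents, which gives Jensen's inequality for it. -/
theorem excess_rpow_tangent_le {A p : ℝ} (hp : 2 < p) (hA : 0 ≤ A) (x z : H) :
    excess A ‖x‖ ^ (p - 1) + (p - 1) * (excess A ‖x‖ ^ (p - 2) * inner ℝ (‖x‖⁻¹ • x) z) ≤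
      excess A ‖x + z‖ ^ (p - 1) := by
  have hW := excess_nonneg A ‖x + z‖
  rcases excess_eq_zero_or A ‖x‖ with h0 | ⟨h0, h1⟩
  · rw [h0, Real.zero_rpow (by linarith), Real.zero_rpow (by linarith)]
    simp only [zero_mul, mul_zero, add_zero]
    positivity
  · have hr : 0 < ‖x‖ := hA.trans_lt h1
    have h2 := rpow_tangent_le (k := p - 1) (by linarith) (excess_nonneg A ‖x‖) hW
    rw [show p - 1 - 1 = p - 2 by ring] at h2
    have h3 : inner ℝ (‖x‖⁻¹ • x) z ≤ excess A ‖x + z‖ - excess A ‖x‖ := by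
      have e : inner ℝ (‖x‖⁻¹ • x) (x + z) ≤ ‖x + z‖ := by
        refine (real_inner_le_norm _ _).trans_eq ?_
        rw [norm_smul, norm_inv, norm_norm, inv_mul_cancel₀ hr.ne', one_mul]
      rw [inner_add_right, inner_smul_left, real_inner_self_eq_norm_sq] at e
      have e2 : ‖x‖⁻¹ * ‖x‖ ^ 2 = ‖x‖ := by field_simp
      simp only [conj_trivial] at e
      have : ‖x + z‖ - A ≤ excess A ‖x + z‖ := le_max_left _ _
      linarith
    have h4 : 0 ≤ excess A ‖x‖ ^ (p - 2) := Real.rpow_nonneg (excess_nonneg _ _) _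
    have h5 := mul_le_mul_of_nonneg_left h3 (mul_nonneg (show 0 ≤ p - 1 by linarith) h4)
    linarith

theorem norm_radialField_le {A p : ℝ} (hp : 2 < p) (hA : 0 ≤ A) (x : H) :
    ‖radialField A p x‖ ≤ ‖x‖ ^ (p - 1) := by
  have hV := excess_nonneg A ‖x‖
  have hp1 : 0 ≤ p - 1 := by linarith
  have hle : excess A ‖x‖ ^ (p - 1) ≤ ‖x‖ ^ (p - 1) := by
    gcongr; exact excess_le hA (norm_nonneg _)
  rw [radialField, norm_smul, radialWeight, Real.norm_of_nonneg (by positivity)]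
  rcases (norm_nonneg x).eq_or_lt with h | h
  · rw [← h]; simp; positivity
  · rwa [div_mul_cancel₀ _ h.ne']

/-- The identity from which the moment bound starts. -/
theorem excess_rpow_eq {A p : ℝ} (hp : 2 < p) (hA : 0 < A) (x : H) :
    excess A ‖x‖ ^ p = inner ℝ x (radialField A p x) - A * excess A ‖x‖ ^ (p - 1) := by
  have hV := excess_nonneg A ‖x‖
  rw [radialField, inner_smul_right, real_inner_self_eq_norm_sq, radialWeight]
  rcases excess_eq_zero_or A ‖x‖ with h0 | ⟨h0, h1⟩
  · rw [h0, Real.zero_rpow (by linarith), Real.zero_rpow (by linarith)]; simp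
  · have : 0 < ‖x‖ := hA.trans h1
    rw [← rpow_sub_one_mul_self hV (show 1 < p by linarith)]
    nth_rewrite 2 [h0]
    field_simp

theorem abs_inner_radialField_le {A p : ℝ} (hp : 2 < p) (hA : 0 ≤ A) {x z : H} :
    |inner ℝ z (radialField A p x)| ≤ 2 ^ p * (‖x‖ ^ p + ‖z‖ ^ p) := by
  refine (abs_real_inner_le_norm _ _).trans ?_
  refine le_trans ?_ (add_rpow_le_two_rpow_mul (by linarith) (norm_nonneg _) (norm_nonneg _))
  rw [← rpow_sub_one_mul_self (by positivity) (show 1 < p by linarith), mul_comm]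
  have h1 : 0 ≤ p - 1 := by linarith
  have h2 := norm_radialField_le hp hA x
  have h3 : ‖x‖ ^ (p - 1) ≤ (‖x‖ + ‖z‖) ^ (p - 1) := by gcongr; simp
  have := h2.trans h3
  have h4 : ‖z‖ ≤ ‖x‖ + ‖z‖ := by simp
  gcongr

/-! ### A Rosenthal-type inequality for norms of sums in a Hilbert space -/

theorem measurable_excess (A : ℝ) : Measurable (excess A) := by
  unfold excess; fun_prop

/-- Independence as equality in law with the decoupled pair on the product space. -/
theorem identDistrib_prod {E F Ω : Type*} [MeasurableSpace E] [MeasurableSpace F]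
    [MeasurableSpace Ω] {μ : Measure Ω} [IsProbabilityMeasure μ] {Y : Ω → E} {X : Ω → F}
    (hY : Measurable Y) (hX : Measurable X)
    (hind : IndepFun Y X μ) :
    IdentDistrib (fun ω => (Y ω, X ω)) (fun q : Ω × Ω => (Y q.1, X q.2)) μ (μ.prod μ) := by
  refine ⟨by fun_prop, by fun_prop, ?_⟩
  rw [hind.map_prod_eq_prod_map_map hY.aemeasurable hX.aemeasurable,
    Measure.map_prod_map μ μ hY hX]
  rfl

theorem integral_prod_inner_eq_zero {H Ω : Type*} [NormedAddCommGroup H]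
    [InnerProductSpace ℝ H] [CompleteSpace H] [MeasurableSpace Ω] {μ : Measure Ω}
    [IsProbabilityMeasure μ] {X g : Ω → H} (hX0 : ∫ ω, X ω ∂μ = 0)
    (hXi : Integrable X μ)
    (hint : Integrable (fun q : Ω × Ω => inner ℝ (X q.2) (g q.1)) (μ.prod μ)) :
    ∫ q : Ω × Ω, inner ℝ (X q.2) (g q.1) ∂(μ.prod μ) = 0 := by
  rw [integral_prod _ hint]
  have : ∀ ω, ∫ ω', inner ℝ (X ω') (g ω) ∂μ = 0 := fun ω => by
    simp_rw [real_inner_comm (g ω)]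
    rw [integral_inner hXi, hX0, inner_zero_right]
  simp [this]

section Moments

variable {H : Type*} [NormedAddCommGroup H] [MeasurableSpace H] [BorelSpace H]
  {Ω : Type*} [MeasurableSpace Ω] {μ : Measure Ω}

theorem rpow_le_one_add_rpow {x k p : ℝ} (hx : 0 ≤ x) (hk : 0 ≤ k) (hkp : k ≤ p) :
    x ^ k ≤ 1 + x ^ p := by
  have hxp : 0 ≤ x ^ p := by positivity
  rcases le_total x 1 with h | h
  · have := Real.rpow_le_one hx h hk
    linarith
  · have := Real.rpow_le_rpow_of_exponent_le h hkp
    linarith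

theorem integrable_norm_rpow_of_le [IsProbabilityMeasure μ] {X : Ω → H} {k p : ℝ}
    (hX : Measurable X)
    (hXp : Integrable (fun ω => ‖X ω‖ ^ p) μ) (hk : 0 ≤ k) (hkp : k ≤ p) :
    Integrable (fun ω => ‖X ω‖ ^ k) μ := by
  refine ((integrable_const (1 : ℝ)).add hXp).mono'
    (hX.norm.pow_const k).aestronglyMeasurable (ae_of_all _ fun ω => ?_)
  rw [Real.norm_of_nonneg (by positivity)]
  exact rpow_le_one_add_rpow (norm_nonneg _) hk hkp

theorem integrable_norm_sq_of_rpow [IsProbabilityMeasure μ] {X : Ω → H} {p : ℝ} (hp : 2 < p)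
    (hX : Measurable X)
    (hXp : Integrable (fun ω => ‖X ω‖ ^ p) μ) : Integrable (fun ω => ‖X ω‖ ^ 2) μ := by
  simpa using integrable_norm_rpow_of_le hX hXp (zero_le_two) hp.le

theorem integrable_of_norm_rpow [IsProbabilityMeasure μ] {X : Ω → H} {p : ℝ}
    [SecondCountableTopology H]
    (hp : 2 < p) (hX : Measurable X)
    (hXp : Integrable (fun ω => ‖X ω‖ ^ p) μ) : Integrable X μ := by
  have := integrable_norm_rpow_of_le hX hXp (zero_le_one) (by linarith)
  simp only [Real.rpow_one] at this
  exact (integrable_norm_iff hX.aestronglyMeasurable).1 this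

theorem integrable_norm_add_rpow {X Y : Ω → H} {p : ℝ} [SecondCountableTopology H]
    (hp : 2 < p) (hX : Measurable X) (hY : Measurable Y)
    (hXp : Integrable (fun ω => ‖X ω‖ ^ p) μ) (hYp : Integrable (fun ω => ‖Y ω‖ ^ p) μ) :
    Integrable (fun ω => ‖X ω + Y ω‖ ^ p) μ := by
  refine ((hXp.add hYp).const_mul (2 ^ p)).mono'
    ((hX.add hY).norm.pow_const p).aestronglyMeasurable (ae_of_all _ fun ω => ?_)
  rw [Real.norm_of_nonneg (by positivity)]
  refine le_trans ?_ (add_rpow_le_two_rpow_mul (by linarith) (norm_nonneg _) (norm_nonneg _))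
  gcongr
  exact norm_add_le _ _

theorem integrable_norm_sum_rpow {ι : Type*} (s : Finset ι) {X : ι → Ω → H} {p : ℝ}
    [SecondCountableTopology H] (hp : 2 < p) (hX : ∀ i, Measurable (X i))
    (hXp : ∀ i, Integrable (fun ω => ‖X i ω‖ ^ p) μ) :
    Integrable (fun ω => ‖∑ i ∈ s, X i ω‖ ^ p) μ := by
  classical
  induction s using Finset.induction_on with
  | empty => simp [Real.zero_rpow (show p ≠ 0 by linarith)]
  | insert a s ha ih =>
    simp only [Finset.sum_insert ha]
    exact integrable_norm_add_rpow hp (hX a) (Finset.measurable_fun_sum _ fun i _ => hX i)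
      (hXp a) ih

theorem integrable_excess_rpow [IsProbabilityMeasure μ] {X : Ω → H} {A k p : ℝ} (hA : 0 ≤ A)
    (hX : Measurable X)
    (hXp : Integrable (fun ω => ‖X ω‖ ^ p) μ) (hk : 0 ≤ k) (hkp : k ≤ p) :
    Integrable (fun ω => excess A ‖X ω‖ ^ k) μ := by
  refine (integrable_norm_rpow_of_le hX hXp hk hkp).mono'
    (((measurable_excess A).comp hX.norm).pow_const k).aestronglyMeasurable
    (ae_of_all _ fun ω => ?_)
  have := excess_nonneg A ‖X ω‖
  rw [Real.norm_of_nonneg (by positivity)]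
  gcongr
  exact excess_le hA (norm_nonneg _)

end Moments

section Decoupling

variable {H : Type*} [NormedAddCommGroup H] [InnerProductSpace ℝ H] [MeasurableSpace H]
  [BorelSpace H] [SecondCountableTopology H]
  {Ω : Type*} [MeasurableSpace Ω] {μ : Measure Ω} [IsProbabilityMeasure μ]

theorem measurable_radialField (A p : ℝ) : Measurable (radialField A p : H → H) := by
  unfold radialField radialWeight
  have := measurable_excess A
  fun_prop

/-- Adding an independent centred summand does not decrease the `(p - 1)`-st moment of the
excess. -/
theorem integral_excess_rpow_le_add [CompleteSpace H] {Y X : Ω → H} {A p : ℝ} (hp : 2 < p)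
    (hA : 0 ≤ A)
    (hY : Measurable Y) (hX : Measurable X) (hind : IndepFun Y X μ)
    (hYp : Integrable (fun ω => ‖Y ω‖ ^ p) μ) (hXp : Integrable (fun ω => ‖X ω‖ ^ p) μ)
    (hX0 : ∫ ω, X ω ∂μ = 0) :
    ∫ ω, excess A ‖Y ω‖ ^ (p - 1) ∂μ ≤ ∫ ω, excess A ‖Y ω + X ω‖ ^ (p - 1) ∂μ := by
  set w : H → H := fun x => excess A ‖x‖ ^ (p - 2) • (‖x‖⁻¹ • x) with hw
  have hwm : Measurable w := by
    have := measurable_excess A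
    rw [hw]; fun_prop
  have hid := identDistrib_prod hY hX hind
  have hYi := integrable_of_norm_rpow hp hY hYp
  have hXi := integrable_of_norm_rpow hp hX hXp
  have hwi : Integrable (fun ω => ‖w (Y ω)‖) μ := by
    refine (integrable_excess_rpow (k := p - 2) hA hY hYp (by linarith) (by linarith)).mono'
      (hwm.comp hY).norm.aestronglyMeasurable (ae_of_all _ fun ω => ?_)
    rw [norm_norm, hw]
    have := excess_nonneg A ‖Y ω‖
    rw [norm_smul, norm_smul, norm_inv, norm_norm, Real.norm_of_nonneg (by positivity)]
    have h1 : ‖Y ω‖⁻¹ * ‖Y ω‖ ≤ 1 := inv_mul_le_one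
    have h2 : 0 ≤ excess A ‖Y ω‖ ^ (p - 2) := by positivity
    nlinarith
  have hI : Integrable (fun q : Ω × Ω => inner ℝ (X q.2) (w (Y q.1))) (μ.prod μ) := by
    refine (hwi.mul_prod hXi.norm).mono' (by fun_prop) (ae_of_all _ fun q => ?_)
    rw [mul_comm]
    exact norm_inner_le_norm _ _
  have hφ : Measurable fun q : H × H => inner ℝ q.2 (w q.1) := by fun_prop
  have hid2 : IdentDistrib (fun ω => inner ℝ (X ω) (w (Y ω)))
      (fun q : Ω × Ω => inner ℝ (X q.2) (w (Y q.1))) μ (μ.prod μ) := hid.comp hφ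
  have hz : ∫ ω, inner ℝ (X ω) (w (Y ω)) ∂μ = 0 := by
    rw [hid2.integral_eq]
    exact integral_prod_inner_eq_zero (g := fun ω => w (Y ω)) hX0 hXi hI
  have hI2 := hid2.integrable_iff.2 hI
  have hSp : Integrable (fun ω => ‖Y ω + X ω‖ ^ p) μ := integrable_norm_add_rpow hp hY hX hYp hXp
  have hSm : Measurable fun ω => Y ω + X ω := by fun_prop
  have h1 := integrable_excess_rpow (k := p - 1) hA hY hYp (by linarith) (by linarith)
  have h2 := integrable_excess_rpow (k := p - 1) hA hSm hSp (by linarith) (by linarith)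
  calc ∫ ω, excess A ‖Y ω‖ ^ (p - 1) ∂μ
      = ∫ ω, (excess A ‖Y ω‖ ^ (p - 1) + (p - 1) * inner ℝ (X ω) (w (Y ω))) ∂μ := by
        rw [integral_add h1 (hI2.const_mul _), integral_const_mul, hz, mul_zero, add_zero]
    _ ≤ _ := by
        refine integral_mono (h1.add (hI2.const_mul _)) h2 fun ω => ?_
        have := excess_rpow_tangent_le hp hA (Y ω) (X ω)
        rw [hw]
        simp only [inner_smul_right]
        rw [← inner_smul_right, real_inner_comm]
        exact this

/-- One summand: the correlation of `X` with the field at `Y + X`, where `Y` is independent of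
`X`. -/
theorem integral_inner_radialField_le [CompleteSpace H] {Y X : Ω → H} {A p η C : ℝ}
    (hp : 2 < p) (hη : 0 ≤ η)
    (hA : 0 < A)
    (hC : ∀ x y z : H, inner ℝ z (radialField A p (x + z)) - inner ℝ z (radialField A p x) ≤
        (1 + η) * (excess A ‖x‖ ^ (p - 1) * ‖z‖ ^ 2 / A)
          + η * (excess A ‖x‖ ^ (p - 1) * ‖y‖ ^ 2 / A)
          + C * (excess A ‖x + y‖ ^ (p - 2) * inner ℝ (‖x + y‖⁻¹ • (x + y)) z ^ 2)
          + C * (‖y‖ ^ p + ‖z‖ ^ p))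
    (hY : Measurable Y) (hX : Measurable X) (hind : IndepFun Y X μ)
    (hYp : Integrable (fun ω => ‖Y ω‖ ^ p) μ) (hXp : Integrable (fun ω => ‖X ω‖ ^ p) μ)
    (hX0 : ∫ ω, X ω ∂μ = 0) :
    Integrable (fun ω => excess A ‖Y ω + X ω‖ ^ (p - 2) *
        ∫ ω', inner ℝ (‖Y ω + X ω‖⁻¹ • (Y ω + X ω)) (X ω') ^ 2 ∂μ) μ ∧
    ∫ ω, inner ℝ (X ω) (radialField A p (Y ω + X ω)) ∂μ ≤
      (1 + 2 * η) / A * (∫ ω, ‖X ω‖ ^ 2 ∂μ) * (∫ ω, excess A ‖Y ω + X ω‖ ^ (p - 1) ∂μ)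
      + C * ∫ ω, excess A ‖Y ω + X ω‖ ^ (p - 2) *
          ∫ ω', inner ℝ (‖Y ω + X ω‖⁻¹ • (Y ω + X ω)) (X ω') ^ 2 ∂μ ∂μ
      + 2 * C * ∫ ω, ‖X ω‖ ^ p ∂μ := by
  have hid := identDistrib_prod hY hX hind
  have hXi := integrable_of_norm_rpow hp hX hXp
  have hX2 := integrable_norm_sq_of_rpow hp hX hXp
  have hV := integrable_excess_rpow (k := p - 1) hA.le hY hYp (by linarith) (by linarith)
  have hSm : Measurable fun ω => Y ω + X ω := by fun_prop
  have hSp : Integrable (fun ω => ‖Y ω + X ω‖ ^ p) μ := integrable_norm_add_rpow hp hY hX hYp hXp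
  have hW := integrable_excess_rpow (k := p - 2) hA.le hSm hSp (by linarith) (by linarith)
  have hvm : Measurable (radialField A p : H → H) := measurable_radialField A p
  have hem := measurable_excess A
  -- the decoupled left side
  have hφ : Measurable fun q : H × H => inner ℝ q.2 (radialField A p (q.1 + q.2)) := by fun_prop
  have hid1 : IdentDistrib (fun ω => inner ℝ (X ω) (radialField A p (Y ω + X ω)))
      (fun q : Ω × Ω => inner ℝ (X q.2) (radialField A p (Y q.1 + X q.2))) μ (μ.prod μ) :=
    hid.comp hφ
  have hF1' : Integrable (fun ω => inner ℝ (X ω) (radialField A p (Y ω + X ω))) μ :=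
    ((hSp.add hXp).const_mul (2 ^ p)).mono' (by fun_prop)
      (ae_of_all _ fun ω => abs_inner_radialField_le hp hA.le)
  have hF1 := hid1.integrable_iff.1 hF1'
  have hF0 : Integrable (fun q : Ω × Ω => inner ℝ (X q.2) (radialField A p (Y q.1)))
      (μ.prod μ) :=
    (((hYp.comp_fst μ).add (hXp.comp_snd μ)).const_mul (2 ^ p)).mono' (by fun_prop)
      (ae_of_all _ fun ω => abs_inner_radialField_le hp hA.le)
  have hF0z := integral_prod_inner_eq_zero (g := fun ω => radialField A p (Y ω)) hX0 hXi hF0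
  -- the terms of the right side
  have hT1 : Integrable (fun q : Ω × Ω => excess A ‖Y q.1‖ ^ (p - 1) * ‖X q.2‖ ^ 2)
      (μ.prod μ) := hV.mul_prod hX2
  have hind' : IndepFun (fun ω => excess A ‖Y ω‖ ^ (p - 1)) (fun ω => ‖X ω‖ ^ 2) μ :=
    hind.comp (φ := fun x => excess A ‖x‖ ^ (p - 1)) (ψ := fun x => ‖x‖ ^ 2) (by fun_prop)
      (by fun_prop)
  have hT2' : Integrable (fun ω => excess A ‖Y ω‖ ^ (p - 1) * ‖X ω‖ ^ 2) μ :=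
    hind'.integrable_mul hV hX2
  have hT2 : Integrable (fun q : Ω × Ω => excess A ‖Y q.1‖ ^ (p - 1) * ‖X q.1‖ ^ 2)
      (μ.prod μ) := hT2'.comp_fst μ
  have hT3 : Integrable (fun q : Ω × Ω => excess A ‖Y q.1 + X q.1‖ ^ (p - 2) *
      inner ℝ (‖Y q.1 + X q.1‖⁻¹ • (Y q.1 + X q.1)) (X q.2) ^ 2) (μ.prod μ) := by
    refine (hW.mul_prod hX2).mono' (by fun_prop) (ae_of_all _ fun q => ?_)
    have := excess_nonneg A ‖Y q.1 + X q.1‖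
    rw [Real.norm_of_nonneg (by positivity)]
    exact mul_le_mul_of_nonneg_left (inner_direction_sq_le (Y q.1 + X q.1) (X q.2))
      (by positivity)
  have hT4 : Integrable (fun q : Ω × Ω => ‖X q.1‖ ^ p + ‖X q.2‖ ^ p) (μ.prod μ) :=
    (hXp.comp_fst μ).add (hXp.comp_snd μ)
  have hT12 : Integrable (fun q : Ω × Ω =>
      (1 + η) / A * (excess A ‖Y q.1‖ ^ (p - 1) * ‖X q.2‖ ^ 2)
        + η / A * (excess A ‖Y q.1‖ ^ (p - 1) * ‖X q.1‖ ^ 2)) (μ.prod μ) :=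
    (hT1.const_mul _).add (hT2.const_mul _)
  have hT123 : Integrable (fun q : Ω × Ω =>
      (1 + η) / A * (excess A ‖Y q.1‖ ^ (p - 1) * ‖X q.2‖ ^ 2)
        + η / A * (excess A ‖Y q.1‖ ^ (p - 1) * ‖X q.1‖ ^ 2)
        + C * (excess A ‖Y q.1 + X q.1‖ ^ (p - 2) *
            inner ℝ (‖Y q.1 + X q.1‖⁻¹ • (Y q.1 + X q.1)) (X q.2) ^ 2)) (μ.prod μ) :=
    hT12.add (hT3.const_mul _)
  have hT3' := hT3.integral_prod_left
  simp only [integral_const_mul] at hT3'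
  refine ⟨hT3', ?_⟩
  have hmono : ∫ q : Ω × Ω, (inner ℝ (X q.2) (radialField A p (Y q.1 + X q.2))
        - inner ℝ (X q.2) (radialField A p (Y q.1))) ∂(μ.prod μ) ≤
      ∫ q : Ω × Ω, ((1 + η) / A * (excess A ‖Y q.1‖ ^ (p - 1) * ‖X q.2‖ ^ 2)
        + η / A * (excess A ‖Y q.1‖ ^ (p - 1) * ‖X q.1‖ ^ 2)
        + C * (excess A ‖Y q.1 + X q.1‖ ^ (p - 2) *
            inner ℝ (‖Y q.1 + X q.1‖⁻¹ • (Y q.1 + X q.1)) (X q.2) ^ 2)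
        + C * (‖X q.1‖ ^ p + ‖X q.2‖ ^ p)) ∂(μ.prod μ) := by
    refine integral_mono (hF1.sub hF0) (hT123.add (hT4.const_mul _)) fun q => ?_
    refine (hC (Y q.1) (X q.1) (X q.2)).trans_eq ?_
    ring
  rw [integral_sub hF1 hF0, hF0z, sub_zero, ← hid1.integral_eq,
    integral_add hT123 (hT4.const_mul _), integral_add hT12 (hT3.const_mul _),
    integral_add (hT1.const_mul _) (hT2.const_mul _), integral_const_mul, integral_const_mul,
    integral_const_mul, integral_const_mul,
    integral_prod_mul (fun ω => excess A ‖Y ω‖ ^ (p - 1)) (fun ω => ‖X ω‖ ^ 2),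
    integral_fun_fst (fun ω => excess A ‖Y ω‖ ^ (p - 1) * ‖X ω‖ ^ 2),
    hind'.integral_fun_mul_eq_mul_integral hV.aestronglyMeasurable hX2.aestronglyMeasurable,
    integral_prod _ hT3, integral_add (hXp.comp_fst μ) (hXp.comp_snd μ),
    integral_fun_fst (fun ω => ‖X ω‖ ^ p), integral_fun_snd (fun ω => ‖X ω‖ ^ p)] at hmono
  simp only [integral_const_mul, probReal_univ, one_smul] at hmono
  have hJ := integral_excess_rpow_le_add hp hA.le hY hX hind hYp hXp hX0
  have hM : 0 ≤ ∫ ω, ‖X ω‖ ^ 2 ∂μ := integral_nonneg fun ω => by positivity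
  refine hmono.trans ?_
  have h5 : (1 + 2 * η) / A * (∫ ω, ‖X ω‖ ^ 2 ∂μ) * (∫ ω, excess A ‖Y ω‖ ^ (p - 1) ∂μ) ≤
      (1 + 2 * η) / A * (∫ ω, ‖X ω‖ ^ 2 ∂μ) * (∫ ω, excess A ‖Y ω + X ω‖ ^ (p - 1) ∂μ) := by
    gcongr
  refine le_trans (le_of_eq ?_) (add_le_add_left (add_le_add_left h5 _) _)
  ring

end Decoupling

/-- A Rosenthal-type deviation inequality for a sum of independent centred vectors: above the level
`A ≥ √(1 + η) (E‖S‖²)^{1/2}`, only the weak variance `l` and the individual `p`-th moments matter.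
The constant does not depend on the Hilbert space or on the number of summands. -/
theorem exists_integral_excess_rpow_le {p η : ℝ} (hp : 2 < p) (hη : 0 < η) :
    ∃ C : ℝ, 0 ≤ C ∧ ∀ (H : Type*) [NormedAddCommGroup H] [InnerProductSpace ℝ H]
      [MeasurableSpace H] [BorelSpace H] [SecondCountableTopology H] [CompleteSpace H]
      (Ω : Type*) [MeasurableSpace Ω] (μ : Measure Ω) [IsProbabilityMeasure μ]
      (N : ℕ) (X : Fin N → Ω → H) (A l : ℝ),
      iIndepFun X μ → (∀ i, Measurable (X i)) → (∀ i, Integrable (fun ω => ‖X i ω‖ ^ p) μ) →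
      (∀ i, ∫ ω, X i ω ∂μ = 0) → 0 < A → (1 + η) * ∑ i, ∫ ω, ‖X i ω‖ ^ 2 ∂μ ≤ A ^ 2 → 0 ≤ l →
      (∀ u : H, ‖u‖ ≤ 1 → ∑ i, ∫ ω, inner ℝ u (X i ω) ^ 2 ∂μ ≤ l) →
      ∫ ω, excess A ‖∑ i, X i ω‖ ^ p ∂μ ≤ C * (∑ i, ∫ ω, ‖X i ω‖ ^ p ∂μ + l ^ (p / 2)) := by
  obtain ⟨C₁, hC₁, h₁⟩ := exists_decoupled_increment_le hp (half_pos hη)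
  obtain ⟨C₂, hC₂, h₂⟩ := exists_mul_rpow_sub_two_le hp hC₁
  refine ⟨4 * C₁ + 2 * C₂, by positivity, ?_⟩
  intro H _ _ _ _ _ _ Ω _ μ _ N X A l hind hXm hXp hX0 hA hM hl hlam
  classical
  set S : Ω → H := fun ω => ∑ i, X i ω with hS
  have hSm : Measurable S := Finset.measurable_fun_sum _ fun i _ => hXm i
  have hSp : Integrable (fun ω => ‖S ω‖ ^ p) μ := integrable_norm_sum_rpow _ hp hXm hXp
  have hem := measurable_excess A
  have hvm : Measurable (radialField A p : H → H) := measurable_radialField A p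
  set Y : Fin N → Ω → H := fun i => ∑ j ∈ Finset.univ.erase i, X j with hY
  have hYX : ∀ i ω, Y i ω + X i ω = S ω := fun i ω => by
    rw [hY, hS]
    simp only [Finset.sum_apply]
    exact Finset.sum_erase_add _ _ (Finset.mem_univ i)
  have hYm : ∀ i, Measurable (Y i) := fun i => by
    convert! Finset.measurable_fun_sum (Finset.univ.erase i) fun j _ => hXm j using 1
    ext ω; simp [hY]
  have hYp : ∀ i, Integrable (fun ω => ‖Y i ω‖ ^ p) μ := fun i => by
    have := integrable_norm_sum_rpow (Finset.univ.erase i) hp hXm hXp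
    simpa only [hY, Finset.sum_apply] using this
  have hstep := fun i => integral_inner_radialField_le (C := C₁) hp (half_pos hη).le hA (h₁ H A hA)
    (hYm i) (hXm i) (hind.indepFun_finsetSum_of_notMem hXm (Finset.notMem_erase i _)) (hYp i)
    (hXp i) (hX0 i)
  simp only [hYX] at hstep
  have hV1 := integrable_excess_rpow (k := p - 1) hA.le hSm hSp (by linarith) (by linarith)
  have hV2 := integrable_excess_rpow (k := p - 2) hA.le hSm hSp (by linarith) (by linarith)
  have hVp := integrable_excess_rpow (k := p) hA.le hSm hSp (by linarith) le_rfl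
  have hin : ∀ i, Integrable (fun ω => inner ℝ (X i ω) (radialField A p (S ω))) μ := fun i =>
    ((hSp.add (hXp i)).const_mul (2 ^ p)).mono'
      ((hXm i).inner (hvm.comp hSm)).aestronglyMeasurable
      (ae_of_all _ fun ω => abs_inner_radialField_le hp hA.le)
  have hEV : ∫ ω, excess A ‖S ω‖ ^ p ∂μ =
      ∑ i, ∫ ω, inner ℝ (X i ω) (radialField A p (S ω)) ∂μ
        - A * ∫ ω, excess A ‖S ω‖ ^ (p - 1) ∂μ := by
    rw [← integral_finsetSum _ fun i _ => hin i, ← integral_const_mul,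
      ← integral_sub (integrable_finsetSum _ fun i _ => hin i) (hV1.const_mul A)]
    refine integral_congr_ae (ae_of_all _ fun ω => ?_)
    simp only
    rw [excess_rpow_eq hp hA, ← sum_inner]
  have hV1n : 0 ≤ ∫ ω, excess A ‖S ω‖ ^ (p - 1) ∂μ :=
    integral_nonneg fun ω => Real.rpow_nonneg (excess_nonneg _ _) _
  -- the terms carrying the weak variance
  have hweak : C₁ * ∑ i, ∫ ω, excess A ‖S ω‖ ^ (p - 2) *
        ∫ ω', inner ℝ (‖S ω‖⁻¹ • S ω) (X i ω') ^ 2 ∂μ ∂μ ≤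
      (∫ ω, excess A ‖S ω‖ ^ p ∂μ) / 2 + C₂ * l ^ (p / 2) := by
    rw [← integral_finsetSum _ fun i _ => (hstep i).1, ← integral_const_mul]
    calc _ ≤ ∫ ω, (excess A ‖S ω‖ ^ p / 2 + C₂ * l ^ (p / 2)) ∂μ := by
          refine integral_mono ((integrable_finsetSum _ fun i _ => (hstep i).1).const_mul _)
            ((hVp.div_const 2).add (integrable_const _)) fun ω => ?_
          simp only
          rw [← Finset.mul_sum]
          refine le_trans ?_ (h₂ _ l (excess_nonneg A ‖S ω‖) hl)
          have hu : ‖‖S ω‖⁻¹ • S ω‖ ≤ 1 := by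
            rw [norm_smul, norm_inv, norm_norm]; exact inv_mul_le_one
          have := Real.rpow_nonneg (excess_nonneg A ‖S ω‖) (p - 2)
          gcongr
          exact hlam _ hu
      _ = _ := by
          rw [integral_add (hVp.div_const 2) (integrable_const _), integral_div]
          simp
  have hdrift : (1 + 2 * (η / 2)) / A * (∑ i, ∫ ω, ‖X i ω‖ ^ 2 ∂μ) *
      (∫ ω, excess A ‖S ω‖ ^ (p - 1) ∂μ) ≤ A * ∫ ω, excess A ‖S ω‖ ^ (p - 1) ∂μ := by
    gcongr
    rw [div_mul_eq_mul_div, div_le_iff₀ hA]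
    calc _ = (1 + η) * ∑ i, ∫ ω, ‖X i ω‖ ^ 2 ∂μ := by ring
      _ ≤ A ^ 2 := hM
      _ = _ := by ring
  have hsum := Finset.sum_le_sum fun i (_ : i ∈ Finset.univ) => (hstep i).2
  rw [Finset.sum_add_distrib, Finset.sum_add_distrib, ← Finset.mul_sum, ← Finset.mul_sum,
    ← Finset.sum_mul, ← Finset.mul_sum] at hsum
  have hlp : 0 ≤ l ^ (p / 2) := by positivity
  have hXpn : 0 ≤ ∑ i, ∫ ω, ‖X i ω‖ ^ p ∂μ :=
    Finset.sum_nonneg fun i _ => integral_nonneg fun ω => by positivity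
  nlinarith [mul_nonneg hC₁ hlp, mul_nonneg hC₂ hXpn]

/-! ### Projections of i.i.d. noise -/

section Blocks

variable {N d : ℕ}

/-- The embedding of `ℝ^d` into `ℝ^{Nd}` as the block of the `i`-th observation. -/
noncomputable def inject (i : Fin N) : EuclideanSpace ℝ (Fin d) →ₗ[ℝ] Obs N d where
  toFun z := WithLp.toLp 2 fun a => if a.1 = i then z a.2 else 0
  map_add' x y := by ext a; by_cases h : a.1 = i <;> simp [h]
  map_smul' c x := by ext a; by_cases h : a.1 = i <;> simp [h]

/-- The `i`-th block of a vector of `ℝ^{Nd}`. -/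
noncomputable def block (i : Fin N) (u : Obs N d) : EuclideanSpace ℝ (Fin d) :=
  WithLp.toLp 2 fun j => u (i, j)

theorem inject_apply (i : Fin N) (z : EuclideanSpace ℝ (Fin d)) (a : Fin N × Fin d) :
    inject i z a = if a.1 = i then z a.2 else 0 := rfl

theorem stack_eq_sum_inject (g : Fin N → EuclideanSpace ℝ (Fin d)) :
    stack g = ∑ i, inject i (g i) := by
  ext a
  simp [stack, inject_apply, WithLp.ofLp_sum, Finset.sum_apply]

theorem inner_inject (u : Obs N d) (i : Fin N) (z : EuclideanSpace ℝ (Fin d)) :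
    inner ℝ u (inject i z) = inner ℝ (block i u) z := by
  simp only [PiLp.inner_apply, Fintype.sum_prod_type, inject_apply, block]
  rw [Finset.sum_eq_single i]
  · simp
  · intro b _ hb; simp [hb]
  · simp

theorem sum_norm_block_sq (u : Obs N d) : ∑ i, ‖block i u‖ ^ 2 = ‖u‖ ^ 2 := by
  simp only [EuclideanSpace.norm_sq_eq, Fintype.sum_prod_type, block]

theorem norm_inject (i : Fin N) (z : EuclideanSpace ℝ (Fin d)) : ‖inject i z‖ = ‖z‖ := by
  have h : ‖inject i z‖ ^ 2 = ‖z‖ ^ 2 := by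
    rw [EuclideanSpace.norm_sq_eq, EuclideanSpace.norm_sq_eq, Fintype.sum_prod_type]
    rw [Finset.sum_eq_single i]
    · simp [inject_apply]
    · intro b _ hb; simp [inject_apply, hb]
    · simp
  exact (sq_eq_sq₀ (norm_nonneg _) (norm_nonneg _)).1 h

theorem inject_eq_sum_single (i : Fin N) (z : EuclideanSpace ℝ (Fin d)) :
    inject i z = ∑ k, z k • EuclideanSpace.single (i, k) (1 : ℝ) := by
  ext a
  simp only [inject_apply, WithLp.ofLp_sum, Finset.sum_apply, PiLp.smul_apply,
    PiLp.single_apply, smul_eq_mul, mul_ite, mul_one, mul_zero]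
  by_cases h : a.1 = i
  · rw [if_pos h, Finset.sum_eq_single a.2]
    · simp [← h]
    · intro b _ hb
      rw [if_neg]; intro hc; rw [hc] at hb; exact hb rfl
    · simp
  · rw [if_neg h]
    symm
    refine Finset.sum_eq_zero fun b _ => if_neg ?_
    intro hc; rw [hc] at h; exact h rfl

variable (L : Submodule ℝ (Obs N d))

theorem norm_proj_le (v : Obs N d) : ‖proj L v‖ ≤ ‖v‖ := L.norm_starProjection_apply_le v

theorem norm_proj_sq (v : Obs N d) : ‖proj L v‖ ^ 2 = inner ℝ v (proj L v) := by
  rw [← real_inner_self_eq_norm_sq]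
  unfold proj
  rw [Submodule.inner_starProjection_left_eq_right,
    Submodule.starProjection_eq_self_iff.2 (Submodule.starProjection_apply_mem L v)]

theorem proj_inject (i : Fin N) (z : EuclideanSpace ℝ (Fin d)) :
    proj L (inject i z) = ∑ k, z k • proj L (EuclideanSpace.single (i, k) (1 : ℝ)) := by
  rw [inject_eq_sum_single]
  simp [proj]

theorem norm_proj_inject_sq (i : Fin N) (z : EuclideanSpace ℝ (Fin d)) :
    ‖proj L (inject i z)‖ ^ 2 = ∑ j, ∑ k, projMatrix L (i, j) (i, k) * (z j * z k) := by
  rw [norm_proj_sq, real_inner_comm, inner_inject, PiLp.inner_apply]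
  refine Finset.sum_congr rfl fun j _ => ?_
  simp only [block, proj_inject, WithLp.ofLp_sum, Finset.sum_apply, PiLp.smul_apply, smul_eq_mul,
    projMatrix, Matrix.of_apply, RCLike.inner_apply, conj_trivial, Finset.mul_sum]
  exact Finset.sum_congr rfl fun k _ => by ring

theorem projMatrix_diag (a : Fin N × Fin d) :
    projMatrix L a a = ‖proj L (EuclideanSpace.single a (1 : ℝ))‖ ^ 2 := by
  rw [norm_proj_sq, EuclideanSpace.inner_single_left]
  simp [projMatrix]

theorem sum_projMatrix_diag : ∑ i, ∑ j, projMatrix L (i, j) (i, j) = dim L := by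
  have h := LinearMap.trace_eq_sum_inner (L.starProjection : Obs N d →ₗ[ℝ] Obs N d)
    (EuclideanSpace.basisFun (Fin N × Fin d) ℝ)
  have hp : LinearMap.IsProj L (L.starProjection : Obs N d →ₗ[ℝ] Obs N d) :=
    ⟨fun x => Submodule.starProjection_apply_mem L x,
      fun x hx => Submodule.starProjection_eq_self_iff.2 hx⟩
  rw [hp.trace] at h
  rw [dim, h, Fintype.sum_prod_type]
  refine Finset.sum_congr rfl fun i _ => Finset.sum_congr rfl fun j _ => ?_
  simp [projMatrix, proj, EuclideanSpace.inner_single_left]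

/-- The Hilbert–Schmidt bound for the `i`-th column block of the projector. -/
theorem norm_proj_inject_sq_le (i : Fin N) (z : EuclideanSpace ℝ (Fin d)) :
    ‖proj L (inject i z)‖ ^ 2 ≤ (∑ j, projMatrix L (i, j) (i, j)) * ‖z‖ ^ 2 := by
  have h1 : ‖proj L (inject i z)‖ ≤
      ∑ k, |z k| * ‖proj L (EuclideanSpace.single (i, k) (1 : ℝ))‖ := by
    rw [proj_inject]
    refine (norm_sum_le _ _).trans_eq (Finset.sum_congr rfl fun k _ => ?_)
    rw [norm_smul, Real.norm_eq_abs]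
  calc ‖proj L (inject i z)‖ ^ 2
      ≤ (∑ k, |z k| * ‖proj L (EuclideanSpace.single (i, k) (1 : ℝ))‖) ^ 2 := by gcongr
    _ ≤ (∑ k, |z k| ^ 2) * ∑ k, ‖proj L (EuclideanSpace.single (i, k) (1 : ℝ))‖ ^ 2 :=
        Finset.sum_mul_sq_le_sq_mul_sq _ _ _
    _ = _ := by
        simp only [EuclideanSpace.norm_sq_eq z, Real.norm_eq_abs, projMatrix_diag]
        ring

/-- Combines the Hilbert–Schmidt bound with `‖P‖ ≤ 1`; summing over `i` produces the factor `D`,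
rather than `D ^ (p / 2)`. -/
theorem norm_proj_inject_rpow_le {p : ℝ} (hp : 2 < p) (i : Fin N)
    (z : EuclideanSpace ℝ (Fin d)) :
    ‖proj L (inject i z)‖ ^ p ≤ (∑ j, projMatrix L (i, j) (i, j)) * ‖z‖ ^ p := by
  have hp2 : 0 ≤ p - 2 := by linarith
  have h1 : ‖proj L (inject i z)‖ ≤ ‖z‖ := (norm_proj_le L _).trans_eq (norm_inject i z)
  rw [← rpow_sub_two_mul_sq (norm_nonneg _) hp, ← rpow_sub_two_mul_sq (norm_nonneg z) hp]
  calc _ ≤ ‖z‖ ^ (p - 2) * ((∑ j, projMatrix L (i, j) (i, j)) * ‖z‖ ^ 2) := by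
        gcongr
        exact norm_proj_inject_sq_le L i z
    _ = _ := by ring

theorem trace_projMatrix_mul_kronecker (Φ : Matrix (Fin d) (Fin d) ℝ) :
    (projMatrix L * ((1 : Matrix (Fin N) (Fin N) ℝ) ⊗ₖ Φ)).trace =
      ∑ i, ∑ j, ∑ k, projMatrix L (i, j) (i, k) * Φ k j := by
  simp only [Matrix.trace, Matrix.diag, Matrix.mul_apply, Fintype.sum_prod_type,
    Matrix.kroneckerMap_apply]
  refine Finset.sum_congr rfl fun i _ => Finset.sum_congr rfl fun j _ => ?_
  rw [Finset.sum_eq_single i]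
  · simp
  · intro b _ hb; simp [hb]
  · simp

theorem deltaSq_mul_dim (hL : 1 ≤ Module.finrank ℝ L) (Φ : Matrix (Fin d) (Fin d) ℝ) :
    deltaSq L Φ * dim L = ∑ i, ∑ j, ∑ k, projMatrix L (i, j) (i, k) * Φ k j := by
  rw [deltaSq, trace_projMatrix_mul_kronecker, div_mul_cancel₀]
  rw [dim]
  have : Module.finrank ℝ L ≠ 0 := by omega
  exact_mod_cast this

theorem measurable_proj_inject (i : Fin N) :
    Measurable fun z : EuclideanSpace ℝ (Fin d) => proj L (inject i z) := by
  unfold proj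
  exact (L.starProjection.continuous.comp (inject i).continuous_of_finiteDimensional).measurable

end Blocks

section Noise

variable {N d : ℕ} [NeZero N] {Ω : Type*} [MeasurableSpace Ω] {μ : Measure Ω}
  [IsProbabilityMeasure μ] {ε : Fin N → Ω → EuclideanSpace ℝ (Fin d)}

/-- Jensen's inequality `(E‖X‖²)^{p/2} ≤ E‖X‖^p`. -/
theorem integral_norm_sq_rpow_le {H : Type*} [NormedAddCommGroup H] {X : Ω → H} {p : ℝ}
    (hp : 2 < p) (h2 : Integrable (fun ω => ‖X ω‖ ^ 2) μ)
    (hpi : Integrable (fun ω => ‖X ω‖ ^ p) μ) :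
    (∫ ω, ‖X ω‖ ^ 2 ∂μ) ^ (p / 2) ≤ ∫ ω, ‖X ω‖ ^ p ∂μ := by
  set l := ∫ ω, ‖X ω‖ ^ 2 ∂μ with hl
  have hl0 : 0 ≤ l := integral_nonneg fun ω => by positivity
  have e : ∀ ω, (‖X ω‖ ^ 2) ^ (p / 2) = ‖X ω‖ ^ p := fun ω => by
    rw [← Real.rpow_natCast, ← Real.rpow_mul (norm_nonneg _)]; congr 1; push_cast; ring
  have h := fun ω => rpow_tangent_le (k := p / 2) (by linarith) hl0 (sq_nonneg ‖X ω‖)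
  simp only [e] at h
  have hi : Integrable (fun ω => l ^ (p / 2) + p / 2 * l ^ (p / 2 - 1) * (‖X ω‖ ^ 2 - l)) μ :=
    (integrable_const _).add ((h2.sub (integrable_const _)).const_mul _)
  have h3 := integral_mono hi hpi h
  have hc : Integrable (fun ω => p / 2 * l ^ (p / 2 - 1) * (‖X ω‖ ^ 2 - l)) μ :=
    (h2.sub (integrable_const _)).const_mul _
  rw [integral_add (integrable_const _) hc, integral_const_mul,
    integral_sub h2 (integrable_const _)] at h3
  simpa [← hl] using h3

/-- The total variance `∑ E‖P ι_i ε_i‖²` of the projected noise is `δ² D`. -/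
theorem integral_norm_proj_inject_sq (L : Submodule ℝ (Obs N d)) {p : ℝ} (hp : 2 < p)
    (hm : ∀ i, Measurable (ε i)) (hid : ∀ i, IdentDistrib (ε i) (ε 0) μ μ)
    (hint : Integrable (fun ω => ‖ε 0 ω‖ ^ p) μ) (h0 : ∫ ω, ε 0 ω ∂μ = 0)
    (hL : 1 ≤ Module.finrank ℝ L) :
    ∑ i, ∫ ω, ‖proj L (inject i (ε i ω))‖ ^ 2 ∂μ = deltaSq L (covMatrix (ε 0) μ) * dim L := by
  have hi := integrable_of_norm_rpow hp (hm 0) hint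
  have h2 := integrable_norm_sq_of_rpow hp (hm 0) hint
  have hmc : ∀ j, Measurable fun ω => ε 0 ω j := fun j =>
    (EuclideanSpace.proj (𝕜 := ℝ) j).continuous.measurable.comp (hm 0)
  have hLp : ∀ j, MemLp (fun ω => ε 0 ω j) 2 μ := fun j => by
    rw [memLp_two_iff_integrable_sq (hmc j).aestronglyMeasurable]
    refine h2.mono' ((hmc j).pow_const 2).aestronglyMeasurable (ae_of_all _ fun ω => ?_)
    rw [Real.norm_of_nonneg (by positivity), ← sq_abs, ← Real.norm_eq_abs]
    gcongr
    exact PiLp.norm_apply_le (ε 0 ω) j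
  have hz : ∀ j, ∫ ω, ε 0 ω j ∂μ = 0 := fun j => by
    have := (EuclideanSpace.proj (𝕜 := ℝ) j).integral_comp_comm hi
    rw [h0, map_zero] at this
    exact this
  have hprod : ∀ j k, Integrable (fun ω => ε 0 ω j * ε 0 ω k) μ := fun j k =>
    (hLp j).integrable_mul (hLp k)
  rw [deltaSq_mul_dim L hL]
  refine Finset.sum_congr rfl fun i _ => ?_
  have hid' : ∫ ω, ‖proj L (inject i (ε i ω))‖ ^ 2 ∂μ = ∫ ω, ‖proj L (inject i (ε 0 ω))‖ ^ 2 ∂μ :=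
    ((hid i).comp ((measurable_proj_inject L i).norm.pow_const 2)).integral_eq
  rw [hid']
  simp only [norm_proj_inject_sq]
  rw [integral_finsetSum _ fun j _ => integrable_finsetSum _ fun k _ => (hprod j k).const_mul _]
  refine Finset.sum_congr rfl fun j _ => ?_
  rw [integral_finsetSum _ fun k _ => (hprod j k).const_mul _]
  refine Finset.sum_congr rfl fun k _ => ?_
  rw [integral_const_mul, covMatrix, Matrix.of_apply, covariance_eq_sub (hLp k) (hLp j), hz,
    zero_mul, sub_zero]
  congr 1
  exact integral_congr_ae (ae_of_all _ fun ω => mul_comm _ _)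

/-- The moment inequality for a sum of images `T i (ε i)` of i.i.d. centred vectors. -/
theorem exists_integral_excess_map_le {p η : ℝ} (hp : 2 < p) (hη : 0 < η) :
    ∃ C : ℝ, 0 ≤ C ∧ ∀ (H : Type*) [NormedAddCommGroup H] [InnerProductSpace ℝ H]
      [MeasurableSpace H] [BorelSpace H] [SecondCountableTopology H] [CompleteSpace H]
      (N d : ℕ) [NeZero N]
      (Ω : Type*) [MeasurableSpace Ω] (μ : Measure Ω) [IsProbabilityMeasure μ]
      (ε : Fin N → Ω → EuclideanSpace ℝ (Fin d)) (T : Fin N → EuclideanSpace ℝ (Fin d) →L[ℝ] H)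
      (A : ℝ) (c : Fin N → ℝ),
      iIndepFun ε μ → (∀ i, Measurable (ε i)) → (∀ i, IdentDistrib (ε i) (ε 0) μ μ) →
      Integrable (fun ω => ‖ε 0 ω‖ ^ p) μ → ∫ ω, ε 0 ω ∂μ = 0 →
      (∀ i z, ‖T i z‖ ^ p ≤ c i * ‖z‖ ^ p) →
      (∀ u : H, ‖u‖ ≤ 1 → ∃ b : Fin N → ℝ,
        (∀ i z, inner ℝ u (T i z) ^ 2 ≤ b i * ‖z‖ ^ 2) ∧ ∑ i, b i ≤ 1) →
      0 < A → (1 + η) * ∑ i, ∫ ω, ‖T i (ε i ω)‖ ^ 2 ∂μ ≤ A ^ 2 →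
      ∫ ω, excess A ‖∑ i, T i (ε i ω)‖ ^ p ∂μ ≤ C * (∑ i, c i + 1) * ∫ ω, ‖ε 0 ω‖ ^ p ∂μ := by
  obtain ⟨C, hC, h⟩ := exists_integral_excess_rpow_le hp hη
  refine ⟨C, hC, ?_⟩
  intro H _ _ _ _ _ _ N d _ Ω _ μ _ ε T A c hind hm hid hint h0 hc hb hA hM
  have hTm : ∀ i, Measurable (T i) := fun i => (T i).continuous.measurable
  have hintp : ∀ i, Integrable (fun ω => ‖ε i ω‖ ^ p) μ := fun i =>
    ((hid i).comp (measurable_norm.pow_const p)).integrable_iff.2 hint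
  have hnp : ∀ i, ∫ ω, ‖ε i ω‖ ^ p ∂μ = ∫ ω, ‖ε 0 ω‖ ^ p ∂μ := fun i =>
    ((hid i).comp (measurable_norm.pow_const p)).integral_eq
  have hn2 : ∀ i, ∫ ω, ‖ε i ω‖ ^ 2 ∂μ = ∫ ω, ‖ε 0 ω‖ ^ 2 ∂μ := fun i =>
    ((hid i).comp (measurable_norm.pow_const 2)).integral_eq
  have hi2 : ∀ i, Integrable (fun ω => ‖ε i ω‖ ^ 2) μ := fun i =>
    integrable_norm_sq_of_rpow hp (hm i) (hintp i)
  have hXm : ∀ i, Measurable fun ω => T i (ε i ω) := fun i => (hTm i).comp (hm i)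
  have hXp : ∀ i, Integrable (fun ω => ‖T i (ε i ω)‖ ^ p) μ := fun i => by
    refine ((hintp i).const_mul (c i)).mono' ((hXm i).norm.pow_const p).aestronglyMeasurable
      (ae_of_all _ fun ω => ?_)
    rw [Real.norm_of_nonneg (by positivity)]
    exact hc i _
  have hl : 0 ≤ ∫ ω, ‖ε 0 ω‖ ^ 2 ∂μ := integral_nonneg fun ω => by positivity
  have key := h H Ω μ N (fun i ω => T i (ε i ω)) A (∫ ω, ‖ε 0 ω‖ ^ 2 ∂μ)
    (hind.comp (fun i => T i) hTm) hXm hXp (fun i => by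
      rw [(T i).integral_comp_comm (integrable_of_norm_rpow hp (hm i) (hintp i)),
        (hid i).integral_eq, h0, map_zero]) hA hM hl (fun u hu => by
      obtain ⟨b, hb1, hb2⟩ := hb u hu
      calc ∑ i, ∫ ω, inner ℝ u (T i (ε i ω)) ^ 2 ∂μ ≤ ∑ i, b i * ∫ ω, ‖ε 0 ω‖ ^ 2 ∂μ := by
            refine Finset.sum_le_sum fun i _ => ?_
            rw [← hn2 i, ← integral_const_mul]
            exact integral_mono_of_nonneg (ae_of_all _ fun ω => sq_nonneg _)
              ((hi2 i).const_mul _) (ae_of_all _ fun ω => hb1 i _)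
        _ = (∑ i, b i) * ∫ ω, ‖ε 0 ω‖ ^ 2 ∂μ := (Finset.sum_mul _ _ _).symm
        _ ≤ 1 * ∫ ω, ‖ε 0 ω‖ ^ 2 ∂μ := by gcongr
        _ = _ := one_mul _)
  refine key.trans ?_
  rw [mul_assoc]
  gcongr
  rw [add_mul, Finset.sum_mul, one_mul]
  refine add_le_add (Finset.sum_le_sum fun i _ => ?_)
    (integral_norm_sq_rpow_le hp (hi2 0) hint)
  rw [← hnp i, ← integral_const_mul]
  exact integral_mono (hXp i) ((hintp i).const_mul _) fun ω => hc i _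

/-- Deviations of `‖P ε‖` above `√((1 + η) δ² D)`. -/
theorem exists_integral_excess_proj_le {p η : ℝ} (hp : 2 < p) (hη : 0 < η) :
    ∃ C : ℝ, 0 ≤ C ∧ ∀ (N d : ℕ) [NeZero N]
      (Ω : Type*) [MeasurableSpace Ω] (μ : Measure Ω) [IsProbabilityMeasure μ]
      (ε : Fin N → Ω → EuclideanSpace ℝ (Fin d)) (L : Submodule ℝ (Obs N d)) (A : ℝ),
      iIndepFun ε μ → (∀ i, Measurable (ε i)) → (∀ i, IdentDistrib (ε i) (ε 0) μ μ) →
      Integrable (fun ω => ‖ε 0 ω‖ ^ p) μ → ∫ ω, ε 0 ω ∂μ = 0 → 1 ≤ Module.finrank ℝ L →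
      0 < A → (1 + η) * (deltaSq L (covMatrix (ε 0) μ) * dim L) ≤ A ^ 2 →
      ∫ ω, excess A ‖proj L (stack fun i => ε i ω)‖ ^ p ∂μ ≤
        C * dim L * ∫ ω, ‖ε 0 ω‖ ^ p ∂μ := by
  obtain ⟨C, hC, h⟩ := exists_integral_excess_map_le hp hη
  refine ⟨C * 2, by positivity, ?_⟩
  intro N d _ Ω _ μ _ ε L A hind hm hid hint h0 hL hA hM
  have hdim : 1 ≤ dim L := by rw [dim]; exact_mod_cast hL
  have hp0 : 0 ≤ ∫ ω, ‖ε 0 ω‖ ^ p ∂μ := integral_nonneg fun ω => by positivity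
  have key := h (Obs N d) N d Ω μ ε
    (fun i => L.starProjection ∘L LinearMap.toContinuousLinearMap (inject i)) A
    (fun i => ∑ j, projMatrix L (i, j) (i, j)) hind hm hid hint h0
    (fun i z => norm_proj_inject_rpow_le L hp i z)
    (fun u hu => ⟨fun i => ‖block i (proj L u)‖ ^ 2, fun i z => by
      have e : inner ℝ u (L.starProjection (inject i z)) = inner ℝ (block i (proj L u)) z := by
        rw [← Submodule.inner_starProjection_left_eq_right]
        exact inner_inject _ i z
      simp only [ContinuousLinearMap.comp_apply, LinearMap.coe_toContinuousLinearMap']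
      rw [e, ← sq_abs, ← mul_pow]
      gcongr
      exact abs_real_inner_le_norm _ _, by
      rw [sum_norm_block_sq]
      exact pow_le_one₀ (norm_nonneg _) ((norm_proj_le L u).trans hu)⟩)
    hA (by
      have := integral_norm_proj_inject_sq L hp hm hid hint h0 hL
      rw [← this] at hM
      exact hM)
  have e : ∀ ω, proj L (stack fun i => ε i ω) = ∑ i,
      (L.starProjection ∘L LinearMap.toContinuousLinearMap (inject i)) (ε i ω) := fun ω => by
    rw [stack_eq_sum_inject, proj, map_sum]; rfl
  simp only [e]
  refine key.trans ?_
  rw [sum_projMatrix_diag]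
  gcongr ?_ * _
  nlinarith

/-- The `p`-th moment of the noise in a fixed direction, from the deviation inequality on the real
line with `A² = 2 E‖ε₁‖²`. -/
theorem exists_integral_inner_stack_le {p : ℝ} (hp : 2 < p) :
    ∃ C : ℝ, 0 ≤ C ∧ ∀ (N d : ℕ) [NeZero N]
      (Ω : Type*) [MeasurableSpace Ω] (μ : Measure Ω) [IsProbabilityMeasure μ]
      (ε : Fin N → Ω → EuclideanSpace ℝ (Fin d)) (u : Obs N d),
      iIndepFun ε μ → (∀ i, Measurable (ε i)) → (∀ i, IdentDistrib (ε i) (ε 0) μ μ) →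
      Integrable (fun ω => ‖ε 0 ω‖ ^ p) μ → ∫ ω, ε 0 ω ∂μ = 0 → ‖u‖ ≤ 1 →
      0 < ∫ ω, ‖ε 0 ω‖ ^ 2 ∂μ →
      ∫ ω, |inner ℝ u (stack fun i => ε i ω)| ^ p ∂μ ≤ C * ∫ ω, ‖ε 0 ω‖ ^ p ∂μ := by
  obtain ⟨C, hC, h⟩ := exists_integral_excess_map_le hp one_pos
  refine ⟨2 ^ p * (C * 2 + 2 ^ (p / 2)), by positivity, ?_⟩
  intro N d _ Ω _ μ _ ε u hind hm hid hint h0 hu hl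
  set l := ∫ ω, ‖ε 0 ω‖ ^ 2 ∂μ with hld
  have hp0 : 0 ≤ ∫ ω, ‖ε 0 ω‖ ^ p ∂μ := integral_nonneg fun ω => by positivity
  have hi2 := integrable_norm_sq_of_rpow hp (hm 0) hint
  have hintp : ∀ i, Integrable (fun ω => ‖ε i ω‖ ^ p) μ := fun i =>
    ((hid i).comp (measurable_norm.pow_const p)).integrable_iff.2 hint
  have hb1 : ∑ i, ‖block i u‖ ^ 2 ≤ 1 := by
    rw [sum_norm_block_sq]; exact pow_le_one₀ (norm_nonneg _) hu
  have hble : ∀ i, ‖block i u‖ ≤ 1 := fun i => by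
    have := Finset.single_le_sum (f := fun i => ‖block i u‖ ^ 2) (fun i _ => sq_nonneg _)
      (Finset.mem_univ i)
    exact (sq_le_one_iff₀ (norm_nonneg _)).1 (this.trans hb1)
  have hsq : ∀ i (z : EuclideanSpace ℝ (Fin d)),
      inner ℝ (block i u) z ^ 2 ≤ ‖block i u‖ ^ 2 * ‖z‖ ^ 2 := fun i z => by
    rw [← sq_abs, ← mul_pow]
    gcongr
    exact abs_real_inner_le_norm _ _
  have hA : 0 < √(2 * l) := Real.sqrt_pos.2 (by positivity)
  have key := h ℝ N d Ω μ ε (fun i => innerSL ℝ (block i u)) (√(2 * l))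
    (fun i => ‖block i u‖ ^ 2) hind hm hid hint h0
    (fun i z => by
      have h1 : ‖innerSL ℝ (block i u) z‖ ≤ ‖block i u‖ * ‖z‖ :=
        norm_inner_le_norm (𝕜 := ℝ) (block i u) z
      calc ‖innerSL ℝ (block i u) z‖ ^ p ≤ (‖block i u‖ * ‖z‖) ^ p := by gcongr
        _ = ‖block i u‖ ^ p * ‖z‖ ^ p := Real.mul_rpow (norm_nonneg _) (norm_nonneg _)
        _ ≤ ‖block i u‖ ^ 2 * ‖z‖ ^ p := by
          gcongr
          rw [← Real.rpow_natCast]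
          rcases (norm_nonneg (block i u)).eq_or_lt with h | h
          · rw [← h, Real.zero_rpow (by linarith)]; positivity
          · exact Real.rpow_le_rpow_of_exponent_ge h (hble i) (by push_cast; linarith))
    (fun r hr => ⟨fun i => ‖block i u‖ ^ 2, fun i z => by
      have : inner ℝ r (innerSL ℝ (block i u) z) = r * inner ℝ (block i u) z := by
        simp [mul_comm]
      rw [this, mul_pow, ← sq_abs r]
      have hr2 : |r| ^ 2 ≤ 1 := pow_le_one₀ (abs_nonneg _) hr
      nlinarith [hsq i z, sq_nonneg (inner ℝ (block i u) z)], hb1⟩)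
    hA (by
      rw [Real.sq_sqrt (by positivity), one_add_one_eq_two]
      gcongr
      calc ∑ i, ∫ ω, ‖innerSL ℝ (block i u) (ε i ω)‖ ^ 2 ∂μ ≤ ∑ i, ‖block i u‖ ^ 2 * l := by
            refine Finset.sum_le_sum fun i _ => ?_
            have e : ∫ ω, ‖ε i ω‖ ^ 2 ∂μ = l :=
              ((hid i).comp (measurable_norm.pow_const 2)).integral_eq
            rw [← e, ← integral_const_mul]
            refine integral_mono_of_nonneg (ae_of_all _ fun ω => by positivity)
              ((integrable_norm_sq_of_rpow hp (hm i) (hintp i)).const_mul _)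
              (ae_of_all _ fun ω => ?_)
            simp only [innerSL_apply_apply, Real.norm_eq_abs, sq_abs]
            exact hsq i _
        _ = (∑ i, ‖block i u‖ ^ 2) * l := (Finset.sum_mul _ _ _).symm
        _ ≤ 1 * l := by gcongr
        _ = l := one_mul l)
  have e : ∀ ω, inner ℝ u (stack fun i => ε i ω) = ∑ i, innerSL ℝ (block i u) (ε i ω) := fun ω => by
    rw [stack_eq_sum_inject, inner_sum]
    exact Finset.sum_congr rfl fun i _ => inner_inject u i _
  simp only [← e, Real.norm_eq_abs] at key
  have hm' : Measurable fun ω => inner ℝ u (stack fun i => ε i ω) := by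
    simp only [e]
    exact Finset.measurable_fun_sum _ fun i _ =>
      (innerSL ℝ (block i u)).continuous.measurable.comp (hm i)
  have hpt : ∀ ω, |inner ℝ u (stack fun i => ε i ω)| ^ p ≤
      2 ^ p * (excess (√(2 * l)) |inner ℝ u (stack fun i => ε i ω)| ^ p + √(2 * l) ^ p) :=
    fun ω => by
      have h1 := excess_nonneg (√(2 * l)) |inner ℝ u (stack fun i => ε i ω)|
      refine le_trans ?_ (add_rpow_le_two_rpow_mul (by linarith) h1 hA.le)
      gcongr
      have : |inner ℝ u (stack fun i => ε i ω)| - √(2 * l) ≤ _ := le_max_left _ 0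
      rw [← sub_le_iff_le_add]
      exact this
  have hip : Integrable (fun ω => ‖inner ℝ u (stack fun i => ε i ω)‖ ^ p) μ := by
    simp only [e]
    refine integrable_norm_sum_rpow _ hp
      (fun i => (innerSL ℝ (block i u)).continuous.measurable.comp (hm i)) fun i => ?_
    refine (hintp i).mono'
      (((innerSL ℝ (block i u)).continuous.measurable.comp
        (hm i)).norm.pow_const p).aestronglyMeasurable
      (ae_of_all _ fun ω => ?_)
    rw [Real.norm_of_nonneg (by positivity)]
    gcongr
    refine (norm_inner_le_norm (𝕜 := ℝ) (block i u) (ε i ω)).trans ?_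
    exact mul_le_of_le_one_left (norm_nonneg _) (hble i)
  have hie := integrable_excess_rpow hA.le hm' hip (show 0 ≤ p by linarith) le_rfl
  have hA2 : √(2 * l) ^ p ≤ 2 ^ (p / 2) * ∫ ω, ‖ε 0 ω‖ ^ p ∂μ := by
    rw [Real.sqrt_eq_rpow, ← Real.rpow_mul (by positivity), show 1 / 2 * p = p / 2 by ring,
      Real.mul_rpow (by norm_num) hl.le]
    gcongr
    exact integral_norm_sq_rpow_le hp hi2 hint
  simp only [Real.norm_eq_abs] at hip hie
  calc ∫ ω, |inner ℝ u (stack fun i => ε i ω)| ^ p ∂μ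
      ≤ ∫ ω, 2 ^ p * (excess (√(2 * l)) |inner ℝ u (stack fun i => ε i ω)| ^ p
          + √(2 * l) ^ p) ∂μ :=
        integral_mono hip ((hie.add (integrable_const _)).const_mul _) hpt
    _ = 2 ^ p * (∫ ω, excess (√(2 * l)) |inner ℝ u (stack fun i => ε i ω)| ^ p ∂μ
          + √(2 * l) ^ p) := by
        rw [integral_const_mul, integral_add hie (integrable_const _)]; simp
    _ ≤ 2 ^ p * (C * (1 + 1) * ∫ ω, ‖ε 0 ω‖ ^ p ∂μ + 2 ^ (p / 2) * ∫ ω, ‖ε 0 ω‖ ^ p ∂μ) := by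
        gcongr
        refine key.trans ?_
        gcongr
    _ = _ := by ring

end Noise

/-! ### From the model selection criterion to moments of the remainder -/

section Selection

variable {N d : ℕ}

/-- The unit vector in the direction of the bias `f - P_L f` (zero if the bias vanishes). -/
noncomputable def biasDirection (L : Submodule ℝ (Obs N d)) (f : Obs N d) : Obs N d :=
  ‖f - proj L f‖⁻¹ • (f - proj L f)

/-- The amount by which the noise `e` along the model `L` and along its bias direction, inflated
by `1 + η`, exceeds the penalty `(1 + θ) a`. -/
noncomputable def remainder (η θ a : ℝ) (L : Submodule ℝ (Obs N d)) (f e : Obs N d) : ℝ :=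
  (1 + η) * (‖proj L e‖ ^ 2 + inner ℝ (biasDirection L f) e ^ 2) - (1 + θ) * a

theorem norm_biasDirection_le (L : Submodule ℝ (Obs N d)) (f : Obs N d) :
    ‖biasDirection L f‖ ≤ 1 := by
  rw [biasDirection, norm_smul, norm_inv, norm_norm]; exact inv_mul_le_one

theorem norm_smul_biasDirection (L : Submodule ℝ (Obs N d)) (f : Obs N d) :
    ‖f - proj L f‖ • biasDirection L f = f - proj L f := by
  rw [biasDirection]
  rcases eq_or_ne (f - proj L f) 0 with h | h
  · rw [h]; simp
  · rw [smul_smul, mul_inv_cancel₀ (norm_ne_zero_iff.2 h), one_smul]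

/-- The deterministic comparison of a selected model `L` with an arbitrary competitor `L₀`. -/
theorem norm_sub_proj_sq_le {η θ a a₀ : ℝ} (hη : 0 < η) (hθ : 0 ≤ θ)
    (L L₀ : Submodule ℝ (Obs N d)) (f e : Obs N d)
    (h : ‖f + e - proj L (f + e)‖ ^ 2 + (1 + θ) * a ≤
      ‖f + e - proj L₀ (f + e)‖ ^ 2 + (1 + θ) * a₀) :
    η / (1 + η) * ‖f - proj L (f + e)‖ ^ 2 ≤
      2 * (1 + θ) * (‖f - proj L₀ f‖ ^ 2 + a₀)
        + max (remainder η θ a L f e) 0 + max (remainder η θ a₀ L₀ f e) 0 := by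
  have hadd : ∀ M : Submodule ℝ (Obs N d), proj M (f + e) = proj M f + proj M e := fun M => by
    simp [proj]
  set w := f - proj L f with hw
  set w₀ := f - proj L₀ f with hw₀
  set i := inner ℝ (biasDirection L f) e with hi
  set i₀ := inner ℝ (biasDirection L₀ f) e with hi₀
  have hwe : inner ℝ w e = ‖w‖ * i := by
    rw [hi, ← real_inner_smul_left, hw, norm_smul_biasDirection]
  have hwe₀ : inner ℝ w₀ e = ‖w₀‖ * i₀ := by
    rw [hi₀, ← real_inner_smul_left, hw₀, norm_smul_biasDirection]
  have horth : inner ℝ w (proj L e) = 0 :=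
    Submodule.starProjection_inner_eq_zero f _ (Submodule.starProjection_apply_mem L e)
  -- the error of the selected estimator
  have e1 : f - proj L (f + e) = w - proj L e := by rw [hadd, hw]; abel
  have n1 : ‖f - proj L (f + e)‖ ^ 2 = ‖w‖ ^ 2 + ‖proj L e‖ ^ 2 := by
    rw [e1, norm_sub_sq_real, horth]; ring
  have n2 : ‖f + e - proj L (f + e)‖ ^ 2 =
      ‖w‖ ^ 2 - ‖proj L e‖ ^ 2 + 2 * (‖w‖ * i) + ‖e‖ ^ 2 := by
    have : f + e - proj L (f + e) = (f - proj L (f + e)) + e := by abel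
    rw [this, norm_add_sq_real, n1, e1, inner_sub_left, hwe, real_inner_comm e (proj L e),
      ← norm_proj_sq]
    ring
  have n3 : ‖f + e - proj L₀ (f + e)‖ ^ 2 ≤ ‖w₀‖ ^ 2 + 2 * (‖w₀‖ * i₀) + ‖e‖ ^ 2 := by
    have hexp : ‖w₀ + e‖ ^ 2 = ‖w₀‖ ^ 2 + 2 * (‖w₀‖ * i₀) + ‖e‖ ^ 2 := by
      rw [norm_add_sq_real, hwe₀]
    have horth₀ : inner ℝ (f + e - proj L₀ (f + e)) (proj L₀ e) = 0 :=
      Submodule.starProjection_inner_eq_zero (f + e) _ (Submodule.starProjection_apply_mem L₀ e)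
    have : w₀ + e = (f + e - proj L₀ (f + e)) + proj L₀ e := by rw [hadd, hw₀]; abel
    rw [← hexp, this, norm_add_sq_real (f + e - proj L₀ (f + e)), horth₀]
    nlinarith [sq_nonneg ‖proj L₀ e‖]
  have r1 : (1 + η) * (‖proj L e‖ ^ 2 + i ^ 2) - (1 + θ) * a ≤ max (remainder η θ a L f e) 0 :=
    le_max_left _ _
  have r2 : (1 + η) * (‖proj L₀ e‖ ^ 2 + i₀ ^ 2) - (1 + θ) * a₀ ≤
      max (remainder η θ a₀ L₀ f e) 0 := le_max_left _ _
  set R := max (remainder η θ a L f e) 0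
  set R₀ := max (remainder η θ a₀ L₀ f e) 0
  rw [n1]
  rw [n2] at h
  -- `2 - 1 / (1 + η) ≤ 1 + η` and `2 x y ≤ x² / (1 + η) + (1 + η) y²`
  have hη1 : 0 < 1 + η := by linarith
  have c1 : η / (1 + η) = 1 - 1 / (1 + η) := by field_simp; ring
  have c2 : 2 ≤ 1 / (1 + η) + (1 + η) := by
    rw [div_add' _ _ _ hη1.ne', le_div_iff₀ hη1]; nlinarith
  have c3 : -(2 * (‖w‖ * i)) ≤ 1 / (1 + η) * ‖w‖ ^ 2 + (1 + η) * i ^ 2 := by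
    have : 0 ≤ 1 / (1 + η) * (‖w‖ + (1 + η) * i) ^ 2 := by positivity
    have e : 1 / (1 + η) * (‖w‖ + (1 + η) * i) ^ 2 =
      1 / (1 + η) * ‖w‖ ^ 2 + 2 * (‖w‖ * i) + (1 + η) * i ^ 2 := by
      field_simp; ring
    linarith
  have c4 : 2 * (‖w₀‖ * i₀) ≤ ‖w₀‖ ^ 2 + i₀ ^ 2 := by nlinarith [sq_nonneg (‖w₀‖ - i₀)]
  have c5 : i₀ ^ 2 ≤ (1 + η) * (‖proj L₀ e‖ ^ 2 + i₀ ^ 2) := by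
    nlinarith [sq_nonneg i₀, sq_nonneg ‖proj L₀ e‖, mul_nonneg hη.le (sq_nonneg i₀),
      mul_nonneg hη.le (sq_nonneg ‖proj L₀ e‖)]
  have c6 := mul_le_mul_of_nonneg_right c2 (sq_nonneg ‖proj L e‖)
  have c7 := mul_nonneg hθ (sq_nonneg ‖w₀‖)
  rw [c1]
  generalize 1 / (1 + η) = x at *
  linarith

end Selection

section RemainderMoment

/-- The slack `s` left in the penalty lowers the exponent from `r` to `q`: where `R > 0`, already
`Y ≥ s`. -/
theorem max_zero_rpow_le {R Y s q r : ℝ} (hs : 0 < s) (hY : 0 ≤ Y) (hR : R ≤ Y - s) (hq : 0 < q)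
    (hqr : q ≤ r) : max R 0 ^ q ≤ Y ^ r * s ^ (q - r) := by
  rcases le_total R 0 with h | h
  · rw [max_eq_right h, Real.zero_rpow hq.ne']; positivity
  · rw [max_eq_left h]
    have hYs : s ≤ Y := by linarith
    have hY0 : 0 < Y := hs.trans_le hYs
    calc R ^ q ≤ Y ^ q := by gcongr; linarith
      _ = Y ^ r * Y ^ (q - r) := by rw [← Real.rpow_add hY0]; ring_nf
      _ ≤ Y ^ r * s ^ (q - r) := by
        gcongr ?_ * ?_
        exact Real.rpow_le_rpow_of_nonpos hs hYs (by linarith)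

theorem measurable_stack {N d : ℕ} {Ω : Type*} [MeasurableSpace Ω]
    {ε : Fin N → Ω → EuclideanSpace ℝ (Fin d)} (hm : ∀ i, Measurable (ε i)) :
    Measurable fun ω => stack fun i => ε i ω := by
  simp only [stack_eq_sum_inject]
  exact Finset.measurable_fun_sum _ fun i _ =>
    (inject i).continuous_of_finiteDimensional.measurable.comp (hm i)

theorem integrable_norm_stack_rpow {N d : ℕ} [NeZero N] {Ω : Type*} [MeasurableSpace Ω]
    {μ : Measure Ω} {p : ℝ} (hp : 2 < p)
    {ε : Fin N → Ω → EuclideanSpace ℝ (Fin d)} (hm : ∀ i, Measurable (ε i))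
    (hid : ∀ i, IdentDistrib (ε i) (ε 0) μ μ) (hint : Integrable (fun ω => ‖ε 0 ω‖ ^ p) μ) :
    Integrable (fun ω => ‖stack fun i => ε i ω‖ ^ p) μ := by
  simp only [stack_eq_sum_inject]
  refine integrable_norm_sum_rpow (X := fun i ω => inject i (ε i ω)) _ hp
    (fun i => (inject i).continuous_of_finiteDimensional.measurable.comp (hm i)) fun i => ?_
  simp only [norm_inject]
  exact ((hid i).comp (measurable_norm.pow_const p)).integrable_iff.2 hint

/-- A model with `δ² > 0` forces the noise to be nondegenerate. -/
theorem integral_norm_sq_pos {N d : ℕ} [NeZero N] {Ω : Type*} [MeasurableSpace Ω]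
    {μ : Measure Ω} [IsProbabilityMeasure μ] {p : ℝ} (hp : 2 < p)
    {ε : Fin N → Ω → EuclideanSpace ℝ (Fin d)} (hm : ∀ i, Measurable (ε i))
    (hid : ∀ i, IdentDistrib (ε i) (ε 0) μ μ) (hint : Integrable (fun ω => ‖ε 0 ω‖ ^ p) μ)
    (h0 : ∫ ω, ε 0 ω ∂μ = 0) {L : Submodule ℝ (Obs N d)} (hL : 1 ≤ Module.finrank ℝ L)
    (hδ : 0 < deltaSq L (covMatrix (ε 0) μ)) : 0 < ∫ ω, ‖ε 0 ω‖ ^ 2 ∂μ := by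
  have hdim : 1 ≤ dim L := by rw [dim]; exact_mod_cast hL
  have hpos : 0 < deltaSq L (covMatrix (ε 0) μ) * dim L := by positivity
  rw [← integral_norm_proj_inject_sq L hp hm hid hint h0 hL] at hpos
  have hle : ∑ i, ∫ ω, ‖proj L (inject i (ε i ω))‖ ^ 2 ∂μ ≤ N * ∫ ω, ‖ε 0 ω‖ ^ 2 ∂μ := by
    calc _ ≤ ∑ _i : Fin N, ∫ ω, ‖ε 0 ω‖ ^ 2 ∂μ := by
          refine Finset.sum_le_sum fun i _ => ?_
          have e : ∫ ω, ‖ε i ω‖ ^ 2 ∂μ = ∫ ω, ‖ε 0 ω‖ ^ 2 ∂μ :=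
            ((hid i).comp (measurable_norm.pow_const 2)).integral_eq
          rw [← e]
          refine integral_mono_of_nonneg (ae_of_all _ fun ω => by positivity)
            (integrable_norm_sq_of_rpow hp (hm i)
              (((hid i).comp (measurable_norm.pow_const p)).integrable_iff.2 hint))
            (ae_of_all _ fun ω => ?_)
          simp only
          gcongr
          exact (norm_proj_le L _).trans_eq (norm_inject i _)
      _ = _ := by simp
  exact pos_of_mul_pos_right (hpos.trans_le hle) (Nat.cast_nonneg N)

theorem dim_mul_rpow {δ D p q : ℝ} (hδ : 0 < δ) (hD : 0 < D) :
    D * (δ * D) ^ (q - p / 2) = √δ ^ (-p) * D ^ (-(p / 2 - 1 - q)) * δ ^ q := by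
  rw [Real.mul_rpow hδ.le hD.le, Real.sqrt_eq_rpow, ← Real.rpow_mul hδ.le,
    show q - p / 2 = 1 / 2 * -p + q by ring, Real.rpow_add hδ,
    show -(p / 2 - 1 - q) = (1 / 2 * -p + q) + 1 by ring, Real.rpow_add_one hD.ne']
  ring

/-- The contribution of a single model to the final bound. -/
theorem exists_integral_remainder_le {θ η p q : ℝ} (hη : 0 < η) (hηθ : (1 + η) ^ 3 < 1 + θ)
    (hq : 0 < q) (hp : 2 * (1 + q) < p) :
    ∃ C : ℝ, 0 ≤ C ∧ ∀ (N d : ℕ) [NeZero N]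
      (Ω : Type*) [MeasurableSpace Ω] (μ : Measure Ω) [IsProbabilityMeasure μ]
      (ε : Fin N → Ω → EuclideanSpace ℝ (Fin d)) (L : Submodule ℝ (Obs N d)) (f : Obs N d),
      iIndepFun ε μ → (∀ i, Measurable (ε i)) → (∀ i, IdentDistrib (ε i) (ε 0) μ μ) →
      Integrable (fun ω => ‖ε 0 ω‖ ^ p) μ → ∫ ω, ε 0 ω ∂μ = 0 → 1 ≤ Module.finrank ℝ L →
      0 < deltaSq L (covMatrix (ε 0) μ) →
      Integrable (fun ω => max (remainder η θ (deltaSq L (covMatrix (ε 0) μ) * dim L) L f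
        (stack fun i => ε i ω)) 0 ^ q) μ ∧
      ∫ ω, max (remainder η θ (deltaSq L (covMatrix (ε 0) μ) * dim L) L f
        (stack fun i => ε i ω)) 0 ^ q ∂μ ≤
        C * (∫ ω, ‖ε 0 ω‖ ^ p ∂μ) * (√(deltaSq L (covMatrix (ε 0) μ)) ^ (-p) *
          dim L ^ (-(p / 2 - 1 - q)) * deltaSq L (covMatrix (ε 0) μ) ^ q) := by
  have hp2 : 2 < p := by linarith
  have hp0 : 0 ≤ p := by linarith
  obtain ⟨C₁, hC₁, h₁⟩ := exists_integral_excess_proj_le hp2 hη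
  obtain ⟨C₂, hC₂, h₂⟩ := exists_integral_inner_stack_le hp2
  set τ := 1 + θ - (1 + η) ^ 3 with hτ
  have hτ0 : 0 < τ := by linarith
  set c := (1 + η) * (1 + 1 / η) with hc
  have hc0 : 0 < c := by positivity
  set B := c ^ (p / 2) * 2 ^ (p / 2) * τ ^ (q - p / 2) with hB
  have hB0 : 0 ≤ B := by positivity
  refine ⟨B * (C₁ + C₂), by positivity, ?_⟩
  intro N d _ Ω _ μ _ ε L f hind hm hid hint h0 hL hδ
  set δ := deltaSq L (covMatrix (ε 0) μ) with hδd
  have hD : 1 ≤ dim L := by rw [dim]; exact_mod_cast hL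
  set a := δ * dim L with ha
  have ha0 : 0 < a := by positivity
  set A := √((1 + η) * a) with hA
  have hA0 : 0 < A := Real.sqrt_pos.2 (by positivity)
  have hA2 : A ^ 2 = (1 + η) * a := Real.sq_sqrt (by positivity)
  set e : Ω → Obs N d := fun ω => stack fun i => ε i ω with he
  set u := biasDirection L f with hu
  have hem : Measurable e := measurable_stack hm
  have hep : Integrable (fun ω => ‖e ω‖ ^ p) μ := integrable_norm_stack_rpow hp2 hm hid hint
  have hPm : Measurable fun ω => proj L (e ω) := L.starProjection.continuous.measurable.comp hem
  have hum : Measurable fun ω => inner ℝ u (e ω) := by fun_prop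
  have hPp : Integrable (fun ω => ‖proj L (e ω)‖ ^ p) μ := by
    refine hep.mono' (hPm.norm.pow_const p).aestronglyMeasurable (ae_of_all _ fun ω => ?_)
    rw [Real.norm_of_nonneg (by positivity)]
    gcongr
    exact norm_proj_le L _
  have hup : Integrable (fun ω => |inner ℝ u (e ω)| ^ p) μ := by
    refine hep.mono' (hum.norm.pow_const p).aestronglyMeasurable (ae_of_all _ fun ω => ?_)
    rw [Real.norm_of_nonneg (by positivity)]
    gcongr
    refine (abs_real_inner_le_norm _ _).trans ?_
    exact mul_le_of_le_one_left (norm_nonneg _) (norm_biasDirection_le L f)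
  have hVp := integrable_excess_rpow hA0.le hPm hPp hp0 le_rfl
  -- `‖P e‖² ≤ (1 + η) A² + (1 + 1/η) (‖P e‖ - A)₊²`
  have hpt : ∀ ω, max (remainder η θ a L f (e ω)) 0 ^ q ≤
      B * a ^ (q - p / 2) * (excess A ‖proj L (e ω)‖ ^ p + |inner ℝ u (e ω)| ^ p) := fun ω => by
    set V := excess A ‖proj L (e ω)‖ with hV
    have hV0 : 0 ≤ V := excess_nonneg _ _
    set g := inner ℝ u (e ω) with hg
    have hPV : ‖proj L (e ω)‖ ≤ A + V := by
      have : ‖proj L (e ω)‖ - A ≤ V := le_max_left _ _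
      linarith
    have hP2 : ‖proj L (e ω)‖ ^ 2 ≤ (1 + η) * A ^ 2 + (1 + 1 / η) * V ^ 2 := by
      have h1 : ‖proj L (e ω)‖ ^ 2 ≤ (A + V) ^ 2 := by gcongr
      have h2 : 0 ≤ 1 / η * (η * A - V) ^ 2 := by positivity
      have h3 : 1 / η * (η * A - V) ^ 2 = η * A ^ 2 - 2 * (A * V) + 1 / η * V ^ 2 := by
        field_simp; ring
      nlinarith
    have hR : remainder η θ a L f (e ω) ≤ c * (V ^ 2 + g ^ 2) - τ * a := by
      have h1 : (1 + η) * ‖proj L (e ω)‖ ^ 2 ≤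
          (1 + η) * ((1 + η) * A ^ 2 + (1 + 1 / η) * V ^ 2) := by
        gcongr
      have h2 : (1 + η) * g ^ 2 ≤ c * g ^ 2 := by
        gcongr
        rw [hc]
        have : 0 < 1 / η := by positivity
        nlinarith
      rw [hA2] at h1
      rw [remainder, hτ]
      rw [hc] at h2 ⊢
      nlinarith
    have h3 := max_zero_rpow_le (r := p / 2) (mul_pos hτ0 ha0) (by positivity) hR hq (by linarith)
    refine h3.trans ?_
    have h4 : (c * (V ^ 2 + g ^ 2)) ^ (p / 2) ≤
        c ^ (p / 2) * (2 ^ (p / 2) * (V ^ p + |g| ^ p)) := by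
      rw [Real.mul_rpow hc0.le (by positivity)]
      gcongr
      have e1 : ∀ x : ℝ, 0 ≤ x → (x ^ 2) ^ (p / 2) = x ^ p := fun x hx => by
        rw [← Real.rpow_natCast, ← Real.rpow_mul hx]; congr 1; push_cast; ring
      rw [← e1 V hV0, ← e1 |g| (abs_nonneg _), sq_abs]
      exact add_rpow_le_two_rpow_mul (by linarith) (sq_nonneg _) (sq_nonneg _)
    calc _ ≤ c ^ (p / 2) * (2 ^ (p / 2) * (V ^ p + |g| ^ p)) * (τ * a) ^ (q - p / 2) := by gcongr
      _ = _ := by rw [Real.mul_rpow hτ0.le ha0.le, hB]; ring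
  have hdom : Integrable (fun ω => B * a ^ (q - p / 2) *
      (excess A ‖proj L (e ω)‖ ^ p + |inner ℝ u (e ω)| ^ p)) μ := (hVp.add hup).const_mul _
  have hRm : Measurable fun ω => max (remainder η θ a L f (e ω)) 0 ^ q := by
    unfold remainder
    exact ((((hPm.norm.pow_const 2).add (hum.pow_const 2)).const_mul _).sub_const _).max
      measurable_const |>.pow_const q
  have hRi : Integrable (fun ω => max (remainder η θ a L f (e ω)) 0 ^ q) μ := by
    refine hdom.mono' hRm.aestronglyMeasurable (ae_of_all _ fun ω => ?_)
    rw [Real.norm_of_nonneg (by positivity)]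
    exact hpt ω
  refine ⟨hRi, ?_⟩
  have hE0 : 0 ≤ ∫ ω, ‖ε 0 ω‖ ^ p ∂μ := integral_nonneg fun ω => by positivity
  calc ∫ ω, max (remainder η θ a L f (e ω)) 0 ^ q ∂μ
      ≤ B * a ^ (q - p / 2) * (∫ ω, excess A ‖proj L (e ω)‖ ^ p ∂μ
          + ∫ ω, |inner ℝ u (e ω)| ^ p ∂μ) := by
        rw [← integral_add hVp hup, ← integral_const_mul]
        exact integral_mono hRi hdom hpt
    _ ≤ B * a ^ (q - p / 2) * (C₁ * dim L * ∫ ω, ‖ε 0 ω‖ ^ p ∂μ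
          + C₂ * dim L * ∫ ω, ‖ε 0 ω‖ ^ p ∂μ) := by
        gcongr
        · exact h₁ N d Ω μ ε L A hind hm hid hint h0 hL hA0 hA2.ge
        · refine (h₂ N d Ω μ ε u hind hm hid hint h0 (norm_biasDirection_le L f)
            (integral_norm_sq_pos hp2 hm hid hint h0 hL hδ)).trans ?_
          gcongr
          nlinarith
    _ = B * (C₁ + C₂) * (∫ ω, ‖ε 0 ω‖ ^ p ∂μ) * (dim L * (δ * dim L) ^ (q - p / 2)) := by
        rw [ha]; ring
    _ = _ := by rw [dim_mul_rpow hδ (by linarith)]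

end RemainderMoment

/-! ### Control of the penalized estimator -/

theorem covMatrix_congr {d : ℕ} {Ω : Type*} [MeasurableSpace Ω] {μ : Measure Ω}
    {z z' : Ω → EuclideanSpace ℝ (Fin d)} (h : z =ᵐ[μ] z') : covMatrix z μ = covMatrix z' μ := by
  have hi : ∀ j, ∫ ω, z ω j ∂μ = ∫ ω, z' ω j ∂μ := fun j =>
    integral_congr_ae (h.mono fun ω hω => by simp only [hω])
  ext j k
  simp only [covMatrix, Matrix.of_apply, covariance, hi]
  exact integral_congr_ae (h.mono fun ω hω => by simp only [hω])

/-- The noise is measurable only up to null sets, identical distribution providing no more; it is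
replaced by measurable versions. -/
theorem exists_integral_remainder_le_of_aemeasurable {θ η p q : ℝ} (hη : 0 < η)
    (hηθ : (1 + η) ^ 3 < 1 + θ) (hq : 0 < q) (hp : 2 * (1 + q) < p) :
    ∃ C : ℝ, 0 ≤ C ∧ ∀ (N d : ℕ) [NeZero N]
      (Ω : Type*) [MeasurableSpace Ω] (μ : Measure Ω) [IsProbabilityMeasure μ]
      (ε : Fin N → Ω → EuclideanSpace ℝ (Fin d)) (L : Submodule ℝ (Obs N d)) (f : Obs N d),
      iIndepFun ε μ → (∀ i, IdentDistrib (ε i) (ε 0) μ μ) →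
      Integrable (fun ω => ‖ε 0 ω‖ ^ p) μ → ∫ ω, ε 0 ω ∂μ = 0 → 1 ≤ Module.finrank ℝ L →
      0 < deltaSq L (covMatrix (ε 0) μ) →
      Integrable (fun ω => max (remainder η θ (deltaSq L (covMatrix (ε 0) μ) * dim L) L f
        (stack fun i => ε i ω)) 0 ^ q) μ ∧
      ∫ ω, max (remainder η θ (deltaSq L (covMatrix (ε 0) μ) * dim L) L f
        (stack fun i => ε i ω)) 0 ^ q ∂μ ≤
        C * (∫ ω, ‖ε 0 ω‖ ^ p ∂μ) * (√(deltaSq L (covMatrix (ε 0) μ)) ^ (-p) *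
          dim L ^ (-(p / 2 - 1 - q)) * deltaSq L (covMatrix (ε 0) μ) ^ q) := by
  obtain ⟨C, hC, h⟩ := exists_integral_remainder_le hη hηθ hq hp
  refine ⟨C, hC, ?_⟩
  intro N d _ Ω _ μ _ ε L f hind hid hint h0 hL hδ
  have hm : ∀ i, AEMeasurable (ε i) μ := fun i => (hid i).aemeasurable_fst
  set ε' : Fin N → Ω → EuclideanSpace ℝ (Fin d) := fun i => (hm i).mk (ε i) with hε'
  have hm' : ∀ i, Measurable (ε' i) := fun i => (hm i).measurable_mk
  have hae : ∀ i, ε i =ᵐ[μ] ε' i := fun i => (hm i).ae_eq_mk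
  have hid' : ∀ i, IdentDistrib (ε' i) (ε' 0) μ μ := fun i =>
    ((IdentDistrib.of_ae_eq (hm i) (hae i)).symm.trans (hid i)).trans
      (IdentDistrib.of_ae_eq (hm 0) (hae 0))
  have hnorm : (fun ω => ‖ε 0 ω‖ ^ p) =ᵐ[μ] fun ω => ‖ε' 0 ω‖ ^ p :=
    (hae 0).mono fun ω hω => by simp only [hω]
  have hcov := covMatrix_congr (hae 0)
  rw [hcov] at hδ
  have key := h N d Ω μ ε' L f (hind.congr hae) hm' hid' (hint.congr hnorm)
    ((integral_congr_ae (hae 0)).symm.trans h0) hL hδ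
  have hall : ∀ᵐ ω ∂μ, ∀ i, ε' i ω = ε i ω := ae_all_iff.2 fun i => (hae i).symm
  have hR : (fun ω => max (remainder η θ (deltaSq L (covMatrix (ε' 0) μ) * dim L) L f
        (stack fun i => ε' i ω)) 0 ^ q) =ᵐ[μ]
      fun ω => max (remainder η θ (deltaSq L (covMatrix (ε' 0) μ) * dim L) L f
        (stack fun i => ε i ω)) 0 ^ q := hall.mono fun ω hω => by simp only [hω]
  rw [hcov, ← integral_congr_ae hR, integral_congr_ae hnorm]
  exact ⟨key.1.congr hR, key.2⟩

/-- On each event `{m̂ = m}` the estimator is a continuous image of the data. -/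
theorem aemeasurable_proj_selected {N d : ℕ} {Ω ι : Type*} [MeasurableSpace Ω] {μ : Measure Ω}
    [Finite ι] {Y : Ω → Obs N d} (hY : AEMeasurable Y μ) (L : ι → Submodule ℝ (Obs N d))
    {mhat : Ω → ι} (hmhat : ∀ m, MeasurableSet {ω | mhat ω = m}) :
    AEMeasurable (fun ω => proj (L (mhat ω)) (Y ω)) μ := by
  cases nonempty_fintype ι
  classical
  have e : (fun ω => proj (L (mhat ω)) (Y ω)) =
      fun ω => ∑ m, {ω | mhat ω = m}.indicator (fun ω => proj (L m) (Y ω)) ω := by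
    funext ω
    rw [Finset.sum_eq_single (mhat ω)]
    · simp
    · intro m _ hm
      have hω : ω ∉ {ω' | mhat ω' = m} := fun h => hm (Eq.symm h)
      exact Set.indicator_of_notMem hω _
    · simp
  rw [e]
  exact Finset.aemeasurable_fun_sum _ fun m _ =>
    ((L m).starProjection.continuous.measurable.comp_aemeasurable hY).indicator (hmhat m)

/-- The truncated loss is bounded by the sum of the remainders of all the models, the selected and
the oracle model being among them. -/
theorem loss_rpow_le {N d : ℕ} [NeZero N] {ι : Type*} [Fintype ι] [Nonempty ι] {θ η q : ℝ}
    (hη : 0 < η) (hθ : 0 < θ) (hq : 0 < q) (Φ : Matrix (Fin d) (Fin d) ℝ)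
    (L : ι → Submodule ℝ (Obs N d)) (f e : Obs N d) (k : ι)
    (hk : ∀ m, crit θ Φ (f + e) (L k) ≤ crit θ Φ (f + e) (L m)) :
    (max (normSqN (f - proj (L k) (f + e)) - 2 * (1 + θ) * ((1 + η) / η) * oracle Φ f L) 0) ^ q ≤
      2 * (2 * ((1 + η) / η)) ^ q / (N : ℝ) ^ q *
        ∑ m, max (remainder η θ (deltaSq (L m) Φ * dim (L m)) (L m) f e) 0 ^ q := by
  have hN : (0 : ℝ) < N := Nat.cast_pos.mpr (NeZero.pos N)
  obtain ⟨m₀, hm₀⟩ := exists_eq_ciInf_of_finite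
    (f := fun m => normSqN (f - proj (L m) f) + deltaSq (L m) Φ * dim (L m) / N)
  rw [oracle, ← hm₀]
  set κ := (1 + η) / η with hκ
  have hκ0 : 0 < κ := by positivity
  have hcrit := hk m₀
  simp only [crit, pen, normSqN_eq] at hcrit ⊢
  set R : ι → ℝ := fun m =>
    max (remainder η θ (deltaSq (L m) Φ * dim (L m)) (L m) f e) 0 with hR
  have hR0 : ∀ m, 0 ≤ R m := fun m => le_max_right _ _
  have hcrit' : ‖f + e - proj (L k) (f + e)‖ ^ 2 + (1 + θ) * (deltaSq (L k) Φ * dim (L k)) ≤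
      ‖f + e - proj (L m₀) (f + e)‖ ^ 2 + (1 + θ) * (deltaSq (L m₀) Φ * dim (L m₀)) := by
    have := mul_le_mul_of_nonneg_right hcrit hN.le
    have e1 : ∀ x y : ℝ, (x / N + (1 + θ) * (y / N)) * N = x + (1 + θ) * y := fun x y => by
      field_simp
    rwa [e1, e1] at this
  have hdet := norm_sub_proj_sq_le hη hθ.le (L k) (L m₀) f e hcrit'
  set F := ‖f - proj (L k) (f + e)‖ ^ 2
  set G := ‖f - proj (L m₀) f‖ ^ 2
  set a₀ := deltaSq (L m₀) Φ * dim (L m₀)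
  have hF : F ≤ κ * (2 * (1 + θ) * (G + a₀) + R k + R m₀) := by
    have h1 : F = κ * (η / (1 + η) * F) := by
      rw [hκ]; field_simp
    rw [h1]
    gcongr
  have hle : max (F / N - 2 * (1 + θ) * κ * (G / N + a₀ / N)) 0 ≤ κ / N * (R k + R m₀) := by
    refine max_le ?_ (mul_nonneg (by positivity) (add_nonneg (hR0 _) (hR0 _)))
    have h1 : F / N - 2 * (1 + θ) * κ * (G / N + a₀ / N) =
        (F - 2 * (1 + θ) * κ * (G + a₀)) / N := by ring
    rw [h1, div_mul_eq_mul_div]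
    gcongr
    linarith
  have hsum : ∀ m, R m ^ q ≤ ∑ m, R m ^ q := fun m =>
    Finset.single_le_sum (f := fun m => R m ^ q) (fun m _ => Real.rpow_nonneg (hR0 m) q)
      (Finset.mem_univ m)
  calc _ ≤ (κ / N * (R k + R m₀)) ^ q := Real.rpow_le_rpow (le_max_right _ _) hle hq.le
    _ = (κ / N) ^ q * (R k + R m₀) ^ q :=
        Real.mul_rpow (by positivity) (add_nonneg (hR0 _) (hR0 _))
    _ ≤ (κ / N) ^ q * (2 ^ q * (R k ^ q + R m₀ ^ q)) := by
        gcongr; exact add_rpow_le_two_rpow_mul hq.le (hR0 _) (hR0 _)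
    _ ≤ (κ / N) ^ q * (2 ^ q * (∑ m, R m ^ q + ∑ m, R m ^ q)) := by
        gcongr
        · exact hsum k
        · exact hsum m₀
    _ = _ := by
        rw [Real.div_rpow hκ0.le hN.le, Real.mul_rpow zero_le_two hκ0.le]; ring

end MultiReg

theorem proposition4p1 :
    ∀ θ : ℝ, 0 < θ → ∃ K : ℝ, 1 < K ∧
    ∀ q p : ℝ, 0 < q → 2 * (1 + q) < p → ∃ C : ℝ, 0 < C ∧
    ∀ (N d : ℕ) [NeZero N]
      -- the probability space and the i.i.d. centered noise with finite `p`-th moment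
      (Ω : Type*) [MeasurableSpace Ω] (μ : Measure Ω) [IsProbabilityMeasure μ]
      (ε : Fin N → Ω → EuclideanSpace ℝ (Fin d)) (Φ : Matrix (Fin d) (Fin d) ℝ),
      iIndepFun ε μ →
      (∀ i, IdentDistrib (ε i) (ε 0) μ μ) →
      Integrable (fun ω => ‖ε 0 ω‖ ^ p) μ →
      ∫ ω, ε 0 ω ∂μ = 0 →
      MultiReg.covMatrix (ε 0) μ = Φ →
    ∀ -- the nonrandom signal and the data
      (f : Fin N → EuclideanSpace ℝ (Fin d)) (y : Fin N → Ω → EuclideanSpace ℝ (Fin d)),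
      (∀ i ω, y i ω = f i + ε i ω) →
    ∀ -- the finite family of models
      (ι : Type*) [Fintype ι] [Nonempty ι]
      (L : ι → Submodule ℝ (MultiReg.Obs N d)),
      (∀ m, 1 ≤ Module.finrank ℝ (L m)) →
      (∀ m, 0 < MultiReg.deltaSq (L m) Φ) →
    ∀ -- any measurable selection of a minimizer of the penalized criterion
      (mhat : Ω → ι),
      (∀ m, MeasurableSet {ω | mhat ω = m}) →
      (∀ ω m, MultiReg.crit θ Φ (MultiReg.stack fun i => y i ω) (L (mhat ω)) ≤
        MultiReg.crit θ Φ (MultiReg.stack fun i => y i ω) (L m)) →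
    ∀ -- the penalized estimator
      (ftilde : Ω → MultiReg.Obs N d),
      (∀ ω, ftilde ω = MultiReg.proj (L (mhat ω)) (MultiReg.stack fun i => y i ω)) →
      Integrable (fun ω => (max (MultiReg.normSqN (MultiReg.stack f - ftilde ω)
        - K * MultiReg.oracle Φ (MultiReg.stack f) L) 0) ^ q) μ ∧
      ∫ ω, (max (MultiReg.normSqN (MultiReg.stack f - ftilde ω)
        - K * MultiReg.oracle Φ (MultiReg.stack f) L) 0) ^ q ∂μ
      ≤ (C * (∫ ω, ‖ε 0 ω‖ ^ p ∂μ) *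
          ∑ m, Real.sqrt (MultiReg.deltaSq (L m) Φ) ^ (-p) *
            MultiReg.dim (L m) ^ (-(p / 2 - 1 - q)))
        * MultiReg.deltaSupSq Φ L ^ q / (N : ℝ) ^ q := by
  intro θ hθ
  -- any `η > 0` with `(1 + η)³ < 1 + θ` works
  obtain ⟨η, hη, hηθ⟩ : ∃ η : ℝ, 0 < η ∧ (1 + η) ^ 3 < 1 + θ := by
    refine ⟨min 1 (θ / 8), by positivity, ?_⟩
    have h1 : min 1 (θ / 8) ≤ 1 := min_le_left _ _
    have h2 : min 1 (θ / 8) ≤ θ / 8 := min_le_right _ _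
    have h3 : 0 < min 1 (θ / 8) := by positivity
    generalize min 1 (θ / 8) = η at *
    nlinarith [mul_nonneg h3.le (sub_nonneg.2 h1), mul_nonneg (mul_nonneg h3.le h3.le)
      (sub_nonneg.2 h1)]
  set κ := (1 + η) / η with hκ
  have hκ1 : 1 < κ := by rw [hκ, lt_div_iff₀ hη]; linarith
  -- `κ = (1 + η) / η` inverts the factor of the loss in `norm_sub_proj_sq_le`
  refine ⟨2 * (1 + θ) * κ, by nlinarith, fun q p hq hp => ?_⟩
  obtain ⟨C, hC, h⟩ := MultiReg.exists_integral_remainder_le_of_aemeasurable hη hηθ hq hp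
  refine ⟨2 * (2 * κ) ^ q * (C + 1), by positivity, ?_⟩
  intro N d _ Ω _ μ _ ε Φ hind hid hint h0 hΦ f y hy ι _ _ L hL hδ mhat hmhat hmin ftilde hf
  subst hΦ
  set Φ := MultiReg.covMatrix (ε 0) μ
  set S := MultiReg.stack f with hS
  have hN : (0 : ℝ) < N := Nat.cast_pos.mpr (NeZero.pos N)
  have hyS : ∀ ω, (MultiReg.stack fun i => y i ω) = S + MultiReg.stack fun i => ε i ω := fun ω => by
    ext a
    simp [MultiReg.stack, hS, hy]
  simp only [hyS] at hmin hf
  have hrem := fun m => h N d Ω μ ε (L m) S hind hid hint h0 (hL m) (hδ m)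
  set R : ι → Ω → ℝ := fun m ω => max (MultiReg.remainder η θ
    (MultiReg.deltaSq (L m) Φ * MultiReg.dim (L m)) (L m) S (MultiReg.stack fun i => ε i ω)) 0 ^ q
    with hR
  have hpt : ∀ ω, (max (MultiReg.normSqN (S - ftilde ω)
      - 2 * (1 + θ) * κ * MultiReg.oracle Φ S L) 0) ^ q ≤
      2 * (2 * κ) ^ q / (N : ℝ) ^ q * ∑ m, R m ω := fun ω => by
    rw [hf ω]
    exact MultiReg.loss_rpow_le hη hθ hq Φ L S _ (mhat ω) (hmin ω)
  have hdom : Integrable (fun ω => 2 * (2 * κ) ^ q / (N : ℝ) ^ q * ∑ m, R m ω) μ :=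
    (integrable_finsetSum _ fun m _ => (hrem m).1).const_mul _
  have hem : AEMeasurable (fun ω => MultiReg.stack fun i => ε i ω) μ := by
    simp only [MultiReg.stack_eq_sum_inject]
    exact Finset.aemeasurable_fun_sum _ fun i _ =>
      (MultiReg.inject i).continuous_of_finiteDimensional.measurable.comp_aemeasurable
        (hid i).aemeasurable_fst
  have hfm : AEMeasurable ftilde μ := by
    rw [funext hf]
    exact MultiReg.aemeasurable_proj_selected (hem.const_add S) L hmhat
  have hlm : AEMeasurable (fun ω => (max (MultiReg.normSqN (S - ftilde ω)
      - 2 * (1 + θ) * κ * MultiReg.oracle Φ S L) 0) ^ q) μ := by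
    simp only [MultiReg.normSqN_eq]
    exact ((((((hfm.const_sub S).norm.pow_const 2).div_const _).sub_const _).max
      aemeasurable_const).pow_const q)
  have hli : Integrable (fun ω => (max (MultiReg.normSqN (S - ftilde ω)
      - 2 * (1 + θ) * κ * MultiReg.oracle Φ S L) 0) ^ q) μ := by
    refine hdom.mono' hlm.aestronglyMeasurable (ae_of_all _ fun ω => ?_)
    rw [Real.norm_of_nonneg (by positivity)]
    exact hpt ω
  refine ⟨hli, ?_⟩
  have hE0 : 0 ≤ ∫ ω, ‖ε 0 ω‖ ^ p ∂μ := integral_nonneg fun ω => by positivity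
  have hsup : ∀ m, MultiReg.deltaSq (L m) Φ ≤ MultiReg.deltaSupSq Φ L := fun m =>
    le_ciSup (Finite.bddAbove_range fun m => MultiReg.deltaSq (L m) Φ) m
  have hdim : ∀ m, 0 ≤ MultiReg.dim (L m) := fun m => Nat.cast_nonneg _
  calc _ ≤ ∫ ω, 2 * (2 * κ) ^ q / (N : ℝ) ^ q * ∑ m, R m ω ∂μ := integral_mono hli hdom hpt
    _ = 2 * (2 * κ) ^ q / (N : ℝ) ^ q * ∑ m, ∫ ω, R m ω ∂μ := by
        rw [integral_const_mul, integral_finsetSum _ fun m _ => (hrem m).1]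
    _ ≤ 2 * (2 * κ) ^ q / (N : ℝ) ^ q * ∑ m, (C + 1) * (∫ ω, ‖ε 0 ω‖ ^ p ∂μ) *
          (√(MultiReg.deltaSq (L m) Φ) ^ (-p) * MultiReg.dim (L m) ^ (-(p / 2 - 1 - q)) *
            MultiReg.deltaSupSq Φ L ^ q) := by
        gcongr with m
        refine (hrem m).2.trans ?_
        have := hdim m
        have := (hδ m).le
        gcongr
        · linarith
        · exact hsup m
    _ = _ := by
        rw [← Finset.mul_sum, ← Finset.sum_mul]; ring
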